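/- Let $M$ be a closed (compact, without boundary) connected smooth manifold. Let $b_1=b_1(M)$ be the rank of $H_1(M,\mathbb Z)$, and let $\Theta=(H_1(M,\mathbb Z)/\mathrm{Tors})\setminus\{0\}$. Let $\mathcal M(M)$ be the set of continuous Riemannian metrics on $M$, with the distance $$\varrho(g_1,g_2)=\sup_{q\in M}\ \inf\{\rho\ge 0 : e^{-\rho}\|v\|_{g_1}\le\|v\|_{g_2}\le e^{\rho}\|v\|_{g_1}\ \text{ for all } v\in T_qM\}.$$ For $g\in\mathcal M(M)$ and $\theta\in\Theta$ let $l_\theta=l_\theta^g$ be the least length of closed curves in the class $\theta$, that is, the infimum of the $g$-lengths of the piecewise smooth closed curves whose class in $H_1(M,\mathbb Z)/\mathrm{Tors}$ is $\theta$. Let $\mathcal H(b_1)$ be the space of holomorphic functions on the half-plane $\{\operatorname{Re} z>b_1\}$ with the topology of uniform convergence on compact sets. Then for every $g\in\mathcal M(M)$ all the $l_\theta^g$ are positive, and for every $z$ with $\operatorname{Re} z>b_1$ the series $$\zeta_{\mathrm{sys}}(g,z)=\sum_{\theta\in\Theta}\frac1{(l_\theta^g)^z}$$ converges, in the sense that for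 each $t>0$ only finitely many $\theta$ have $l_\theta^g\le t$ and that $\sum_{l_\theta^g\le t}(l_\theta^g)^{-z}$ has a limit as $t\to\infty$. The sum is a holomorphic function of $z$ in this half-plane, and the map $$Z:\mathcal M(M)\to\mathcal H(b_1),\qquad Z(g)=\zeta_{\mathrm{sys}}(g,\cdot),$$ is continuous. -/

import Mathlib

open Set Filter Topology Bundle CategoryTheory
open scoped Manifold ContDiff NNReal ENNReal Simplicial

universe u

noncomputable section

namespace SystolicZeta

/-! ### Continuous Riemannian metrics and the bi-Lipschitz distance -/

section Metrics

variable (m : ℕ) (M : Type u) [TopologicalSpace M] [ChartedSpace (EuclideanSpace ℝ (Fin m)) M]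
  [IsManifold (𝓡 m) ∞ M]

/-- The set `𝓜(M)` of continuous Riemannian metrics on the smooth `m`-manifold `M`. -/
abbrev RiemMetric : Type u :=
  ContinuousRiemannianMetric (EuclideanSpace ℝ (Fin m)) (fun x : M ↦ TangentSpace (𝓡 m) x)

variable {m M}

/-- The norm `‖v‖_g = √(g(v, v))` of a tangent vector. -/
def gnorm (g : RiemMetric m M) (q : M) (v : TangentSpace (𝓡 m) q) : ℝ :=
  √(g.inner q v v)

/-- `e^{-ρ} ‖v‖_{g₁} ≤ ‖v‖_{g₂} ≤ e^ρ ‖v‖_{g₁}` for all tangent vectors `v` at `q`. -/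
def BilipAt (g₁ g₂ : RiemMetric m M) (q : M) (ρ : ℝ≥0) : Prop :=
  ∀ v : TangentSpace (𝓡 m) q,
    Real.exp (-ρ) * gnorm g₁ q v ≤ gnorm g₂ q v ∧ gnorm g₂ q v ≤ Real.exp ρ * gnorm g₁ q v

/-- The bi-Lipschitz distance `ϱ(g₁, g₂) = sup_q inf {ρ ≥ 0 | BilipAt g₁ g₂ q ρ}`.
It is finite when `M` is compact; taking values in `[0, ∞]` avoids any convention about the
supremum of an unbounded set of reals. -/
def varrho (g₁ g₂ : RiemMetric m M) : ℝ≥0∞ :=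
  ⨆ q : M, ⨅ (ρ : ℝ≥0) (_ : BilipAt g₁ g₂ q ρ), (ρ : ℝ≥0∞)

lemma BilipAt.refl (g : RiemMetric m M) (q : M) : BilipAt g g q 0 := by
  intro v; simp

lemma BilipAt.symm {g₁ g₂ : RiemMetric m M} {q : M} {ρ : ℝ≥0} (h : BilipAt g₁ g₂ q ρ) :
    BilipAt g₂ g₁ q ρ := by
  intro v
  obtain ⟨h₁, h₂⟩ := h v
  rw [Real.exp_neg] at h₁ ⊢
  have hp : 0 < Real.exp ρ := Real.exp_pos _
  constructor
  · rwa [inv_mul_le_iff₀ hp]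
  · rwa [inv_mul_le_iff₀ hp] at h₁

lemma BilipAt.trans {g₁ g₂ g₃ : RiemMetric m M} {q : M} {ρ σ : ℝ≥0} (h : BilipAt g₁ g₂ q ρ)
    (h' : BilipAt g₂ g₃ q σ) : BilipAt g₁ g₃ q (ρ + σ) := by
  intro v
  obtain ⟨h₁, h₂⟩ := h v
  obtain ⟨h₃, h₄⟩ := h' v
  constructor
  · refine le_trans ?_ h₃
    have : Real.exp (-((ρ + σ : ℝ≥0) : ℝ)) = Real.exp (-σ) * Real.exp (-ρ) := by
      rw [← Real.exp_add]; push_cast; ring_nf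
    rw [this, mul_assoc]
    gcongr
  · refine le_trans h₄ ?_
    have : Real.exp ((ρ + σ : ℝ≥0) : ℝ) = Real.exp σ * Real.exp ρ := by
      rw [← Real.exp_add]; push_cast; ring_nf
    rw [this, mul_assoc]
    gcongr

lemma varrho_self (g : RiemMetric m M) : varrho g g = 0 := by
  refine le_antisymm (iSup_le fun q ↦ ?_) zero_le
  simpa using iInf₂_le (α := ℝ≥0∞) (f := fun (ρ : ℝ≥0) (_ : BilipAt g g q ρ) ↦ (ρ : ℝ≥0∞))
    0 (BilipAt.refl g q)

lemma varrho_comm (g₁ g₂ : RiemMetric m M) : varrho g₁ g₂ = varrho g₂ g₁ := by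
  have : ∀ q ρ, BilipAt g₁ g₂ q ρ ↔ BilipAt g₂ g₁ q ρ := fun q ρ ↦ ⟨BilipAt.symm, BilipAt.symm⟩
  simp only [varrho, this]

lemma varrho_triangle (g₁ g₂ g₃ : RiemMetric m M) :
    varrho g₁ g₃ ≤ varrho g₁ g₂ + varrho g₂ g₃ := by
  refine iSup_le fun q ↦ le_trans ?_ (add_le_add (le_iSup _ q) (le_iSup _ q))
  simp only [ENNReal.iInf_add, ENNReal.add_iInf]
  refine le_iInf₂ fun σ hσ ↦ le_iInf₂ fun ρ hρ ↦ ?_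
  refine (iInf₂_le (ρ + σ) ?_).trans (by push_cast; exact le_refl _)
  exact hρ.trans hσ

/-- If `ϱ(g₁, g₂) = 0` then `g₁ = g₂`. -/
lemma eq_of_varrho_eq_zero {g₁ g₂ : RiemMetric m M} (h : varrho g₁ g₂ = 0) : g₁ = g₂ := by
  have key : ∀ (q : M) (v : TangentSpace (𝓡 m) q), gnorm g₂ q v = gnorm g₁ q v := by
    intro q v
    have hq : (⨅ (ρ : ℝ≥0) (_ : BilipAt g₁ g₂ q ρ), (ρ : ℝ≥0∞)) = 0 :=
      le_antisymm ((le_iSup (fun q ↦ ⨅ (ρ : ℝ≥0) (_ : BilipAt g₁ g₂ q ρ), (ρ : ℝ≥0∞)) q).trans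
        h.le) zero_le
    have hε : ∀ ε : ℝ, 0 < ε → Real.exp (-ε) * gnorm g₁ q v ≤ gnorm g₂ q v ∧
        gnorm g₂ q v ≤ Real.exp ε * gnorm g₁ q v := by
      intro ε hε
      have hlt : (⨅ (ρ : ℝ≥0) (_ : BilipAt g₁ g₂ q ρ), (ρ : ℝ≥0∞)) < ENNReal.ofReal ε := by
        rw [hq]; exact ENNReal.ofReal_pos.2 hε
      simp only [iInf_lt_iff] at hlt
      obtain ⟨ρ, hρ, hρε⟩ := hlt
      have hle : (ρ : ℝ) ≤ ε := by
        have := (ENNReal.lt_ofReal_iff_toReal_lt ENNReal.coe_ne_top).1 hρε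
        simpa using this.le
      have hn : 0 ≤ gnorm g₁ q v := Real.sqrt_nonneg _
      refine ⟨le_trans ?_ (hρ v).1, (hρ v).2.trans ?_⟩ <;> gcongr
    have hc₁ : Tendsto (fun ε : ℝ ↦ Real.exp (-ε) * gnorm g₁ q v) (𝓝[>] 0)
        (𝓝 (gnorm g₁ q v)) := by
      have : Continuous fun ε : ℝ ↦ Real.exp (-ε) * gnorm g₁ q v := by fun_prop
      simpa using (this.tendsto 0).mono_left nhdsWithin_le_nhds
    have hc₂ : Tendsto (fun ε : ℝ ↦ Real.exp ε * gnorm g₁ q v) (𝓝[>] 0)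
        (𝓝 (gnorm g₁ q v)) := by
      have : Continuous fun ε : ℝ ↦ Real.exp ε * gnorm g₁ q v := by fun_prop
      simpa using (this.tendsto 0).mono_left nhdsWithin_le_nhds
    refine le_antisymm (ge_of_tendsto hc₂ ?_) (le_of_tendsto hc₁ ?_)
    · filter_upwards [self_mem_nhdsWithin] with ε h using (hε ε h).2
    · filter_upwards [self_mem_nhdsWithin] with ε h using (hε ε h).1
  have diag : ∀ (q : M) (v : TangentSpace (𝓡 m) q), g₁.inner q v v = g₂.inner q v v := by
    intro q v
    have hpos : ∀ g : RiemMetric m M, 0 ≤ g.inner q v v := by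
      intro g
      rcases eq_or_ne v 0 with rfl | hv
      · simp
      · exact (g.pos q v hv).le
    have := key q v
    unfold gnorm at this
    rw [Real.sqrt_inj (hpos g₂) (hpos g₁)] at this
    exact this.symm
  have full : g₁.inner = g₂.inner := by
    funext q
    ext v w
    have h₁ := diag q (v + w)
    simp only [map_add, add_apply] at h₁
    rw [diag q v, diag q w, g₁.symm q w v, g₂.symm q w v] at h₁
    linarith
  cases g₁; cases g₂; cases full; rfl

/-- `𝓜(M)` with the distance `ϱ`. -/
instance : EMetricSpace (RiemMetric m M) where
  edist := varrho
  edist_self := varrho_self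
  edist_comm := varrho_comm
  edist_triangle := varrho_triangle
  eq_of_edist_eq_zero := eq_of_varrho_eq_zero

end Metrics

/-! ### First homology and the classes of closed curves -/

section Homology

variable (M : Type u) [TopologicalSpace M]

/-- The complex of singular chains of `M` with integer coefficients. -/
abbrev chains : ChainComplex (ModuleCat.{u} ℤ) ℕ :=
  ((AlgebraicTopology.singularChainComplexFunctor (ModuleCat.{u} ℤ)).obj
    (ModuleCat.of ℤ (ULift.{u} ℤ))).obj (TopCat.of M)

/-- The singular homology group `H₁(M, ℤ)`. -/
abbrev H1 : Type u :=
  ((AlgebraicTopology.singularHomologyFunctor (ModuleCat.{u} ℤ) 1).obj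
    (ModuleCat.of ℤ (ULift.{u} ℤ))).obj (TopCat.of M)

/-- `H₁(M, ℤ) / Tors`. -/
abbrev H1Free : Type u := H1 M ⧸ Submodule.torsion ℤ (H1 M)

/-- The first Betti number `b₁(M)`, the rank of `H₁(M, ℤ)`. -/
def b1 : ℕ := Module.finrank ℤ (H1 M)

/-- The set `Θ` of nonzero elements of `H₁(M, ℤ) / Tors`. -/
abbrev Theta : Type u := {θ : H1Free M // θ ≠ 0}

variable {M}

/-- A curve `γ : [0, 1] → M` as a singular `1`-simplex, `(x₀, x₁) ↦ γ x₁`. -/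
def curveSimplex (γ : ℝ → M) (hγ : ContinuousOn γ (Icc 0 1)) :
    (TopCat.toSSet.obj (TopCat.of M)) _⦋1⦌ :=
  ((TopCat.of M).toSSetObjEquiv (Opposite.op ⦋1⦌)).symm
    ⟨fun x : stdSimplex ℝ (Fin 2) ↦ γ (x.1 1), by
      refine hγ.comp_continuous ?_ fun x ↦ ?_
      · exact (continuous_apply 1).comp continuous_subtype_val
      · exact ⟨x.2.1 1, (mem_Icc_of_mem_stdSimplex x.2 1).2⟩⟩

/-- The singular `1`-simplex of a closed curve is a cycle. -/
lemma curveSimplex_cycle (γ : ℝ → M) (hγ : ContinuousOn γ (Icc 0 1)) (h01 : γ 0 = γ 1) :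
    SSet.ιChainComplex (R := ModuleCat.of ℤ (ULift.{u} ℤ)) _ (curveSimplex γ hγ) ≫
      (chains M).d 1 0 = 0 := by
  have hδ : (TopCat.toSSet.obj (TopCat.of M)).δ 0 (curveSimplex γ hγ) =
      (TopCat.toSSet.obj (TopCat.of M)).δ 1 (curveSimplex γ hγ) := by
    apply ((TopCat.of M).toSSetObjEquiv _).injective
    ext x
    obtain rfl := Subsingleton.elim x (stdSimplex.vertex (S := ℝ) (0 : Fin 1))
    have h0 : (stdSimplex.map (Fin.succAbove (0 : Fin 2))
        (stdSimplex.vertex (S := ℝ) (0 : Fin 1))).1 1 = 1 := by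
      rw [stdSimplex.map_vertex]; simp
    have h1 : (stdSimplex.map (Fin.succAbove (1 : Fin 2))
        (stdSimplex.vertex (S := ℝ) (0 : Fin 1))).1 1 = 0 := by
      rw [stdSimplex.map_vertex]; simp
    change γ ((stdSimplex.map (Fin.succAbove (0 : Fin 2))
        (stdSimplex.vertex (S := ℝ) (0 : Fin 1))).1 1) =
      γ ((stdSimplex.map (Fin.succAbove (1 : Fin 2))
        (stdSimplex.vertex (S := ℝ) (0 : Fin 1))).1 1)
    rw [h0, h1, h01]
  refine (SSet.ιChainComplex_d _ _ _).trans ?_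
  rw [Fin.sum_univ_two, hδ]
  simp
  rfl

/-- The homology class in `H₁(M, ℤ)` of a closed curve `γ : [0, 1] → M`. -/
def curveClass (γ : ℝ → M) (hγ : ContinuousOn γ (Icc 0 1)) (h01 : γ 0 = γ 1) : H1 M :=
  ((chains M).liftCycles
      (SSet.ιChainComplex (R := ModuleCat.of ℤ (ULift.{u} ℤ)) _ (curveSimplex γ hγ)) 0 (by simp)
      (curveSimplex_cycle γ hγ h01) ≫ (chains M).homologyπ 1).hom ⟨1⟩

end Homology

/-! ### The homology length spectrum -/

section Spectrum

variable {m : ℕ} {M : Type u} [TopologicalSpace M] [ChartedSpace (EuclideanSpace ℝ (Fin m)) M]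
  [IsManifold (𝓡 m) ∞ M]

variable (m M) in
/-- Piecewise smooth closed curves `γ : [0, 1] → M`
(the values of `γ` outside of `[0, 1]` are irrelevant). -/
structure ClosedCurve where
  toFun : ℝ → M
  continuousOn : ContinuousOn toFun (Icc 0 1)
  closed : toFun 0 = toFun 1
  piecewise : ∃ (n : ℕ) (t : ℕ → ℝ), t 0 = 0 ∧ t n = 1 ∧ Monotone t ∧
    ∀ i < n, ContMDiffOn 𝓘(ℝ) (𝓡 m) ∞ toFun (Icc (t i) (t (i + 1)))

/-- The class in `H₁(M, ℤ) / Tors` of a closed curve. -/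
def ClosedCurve.toH1Free (γ : ClosedCurve m M) : H1Free M :=
  Submodule.Quotient.mk (curveClass γ.toFun γ.continuousOn γ.closed)

/-- The length `∫₀¹ ‖γ'(t)‖_g dt` of a closed curve. -/
def length (g : RiemMetric m M) (γ : ClosedCurve m M) : ℝ≥0∞ :=
  letI : RiemannianBundle (fun x : M ↦ TangentSpace (𝓡 m) x) := ⟨g.toRiemannianMetric⟩
  Manifold.pathELength (𝓡 m) γ.toFun 0 1

/-- The homology length spectrum: `l_θ` is the least length, i.e. the infimum of the lengths,
of the closed curves in the homology class `θ`. -/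
def spectrum (g : RiemMetric m M) (θ : H1Free M) : ℝ :=
  (⨅ (γ : ClosedCurve m M) (_ : γ.toH1Free = θ), length g γ).toReal

end Spectrum

/-! ### Zeta functions of marked spectra and spaces of holomorphic functions -/

/-- The zeta series `∑_θ 1 / l_θ ^ z` converges to `s`: for all `t > 0` only finitely many `θ`
have `l_θ ≤ t`, and the sums over these `θ` tend to `s` as `t → ∞`. -/
def ZetaConvergesTo {Θ : Type*} (l : Θ → ℝ) (z s : ℂ) : Prop :=
  (∀ t : ℝ, 0 < t → {θ | l θ ≤ t}.Finite) ∧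
    Tendsto (fun t : ℝ ↦ ∑ᶠ θ ∈ {θ | l θ ≤ t}, 1 / (l θ : ℂ) ^ z) atTop (𝓝 s)

/-- The half-plane `Re z > b`. -/
def halfPlane (b : ℝ) : Set ℂ := {z | b < z.re}

/-- The space `𝓗(b)` of holomorphic functions on the half-plane `Re z > b`. It has the topology
induced by the compact-open topology of `C(halfPlane b, ℂ)`, which is the topology of uniform
convergence on compact sets. -/
abbrev Holo (b : ℝ) : Type :=
  {f : C(halfPlane b, ℂ) //
    ∃ F : ℂ → ℂ, DifferentiableOn ℂ F (halfPlane b) ∧ ∀ z : halfPlane b, f z = F z}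

end SystolicZeta

end

/-!
Everything follows from a comparison of the homology length spectrum with a norm on the lattice
`H₁(M, ℤ) / Tors`, which is established without differential forms.

Paths that are not closed have a class in the group of singular `1`-chains modulo boundaries, whose
subgroup of cycles is `H₁(M, ℤ)`. On a chart ball the class of a path is the increment of a
primitive: the class of the segment from the center to the moving end point
(`exists_local_primitive`). On the overlap of two balls the difference of the two primitives is
locally constant. By compactness, `M` is therefore covered by finitely many open sets with
primitives whose differences take finitely many values (`nonempty_primitiveCover`), and these
differences are classes of piecewise smooth loops. Cutting a closed path into `N` arcs, each inside
a member of the cover, and summing by parts exhibits its class as a sum of `N` of these differences.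
Three facts result:

* `H₁(M, ℤ)` is finitely generated (`PrimitiveCover.finite_H1`), so that `H₁(M, ℤ) / Tors` is a
  lattice of rank `b₁`;
* every class is represented by a piecewise smooth closed curve
  (`PrimitiveCover.exists_closedCurve`), so that all `l_θ` are finite;
* for a Riemannian metric, the cover has a Lebesgue number `ε`, a curve of length `ℓ` can be cut
  into `⌊ℓ / ε⌋ + 1` arcs, and a closed curve shorter than `ε` is null-homologous. So any norm of
  the class of a closed curve is at most a constant times its length
  (`PrimitiveCover.exists_norm_curveClass_le`), that is, `c ‖θ‖ ≤ l_θ` with `c > 0`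
  (`PrimitiveCover.exists_norm_le_spectrum`).

Hence the zeta series is dominated by `∑ ‖θ‖ ^ (-s)` over a lattice of rank `b₁`, which converges
for `s > b₁`. Metrics at distance less than `ρ` have spectra that differ at most by a factor `e^ρ`
(`PrimitiveCover.spectrum_le_of_bilipAt`), so the domination is uniform for metrics near a given
one and for `z` in a strip `σ ≤ Re z ≤ τ` with `σ > b₁`. Uniform convergence gives the holomorphy
of the sum, and its joint continuity in the metric and in `z`, from which the continuity of `Z`
for the compact-open topology follows by currying.
-/

noncomputable section

namespace SystolicZeta

/-! ### Classes of paths modulo boundaries -/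

section PathClass

variable (M : Type u) [TopologicalSpace M]

/-- Singular `1`-chains of `M` modulo boundaries. It contains `H₁(M, ℤ)` as the kernel of the
boundary map, and unlike `H₁(M, ℤ)` it also has a class for every path that is not closed. -/
abbrev ChainsModBoundaries : Type u := (chains M).opcycles 1

/-- The boundary map from `1`-chains modulo boundaries to `0`-chains. -/
def bdry : ChainsModBoundaries M →ₗ[ℤ] (chains M).X 0 :=
  ((chains M).fromOpcycles 1 0).hom

/-- The inclusion of `H₁(M, ℤ)` in the `1`-chains modulo boundaries. -/
def H1Incl : H1 M →ₗ[ℤ] ChainsModBoundaries M := ((chains M).homologyι 1).hom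

lemma H1Incl_injective : Function.Injective (H1Incl M) :=
  (ModuleCat.mono_iff_injective _).1 (inferInstanceAs (Mono ((chains M).homologyι 1)))

lemma range_H1Incl : LinearMap.range (H1Incl M) = LinearMap.ker (bdry M) := by
  have h : (ShortComplex.mk _ _ ((chains M).homologyι_comp_fromOpcycles 1 0)).Exact :=
    ShortComplex.exact_of_f_is_kernel _ ((chains M).homologyIsKernel 1 0 (by simp))
  exact h.moduleCat_range_eq_ker

variable {M}

/-- The generator of the group of `n`-chains given by a singular `n`-simplex, as a morphism
from `ℤ`. -/
def chainGen {n : ℕ} (s : (TopCat.toSSet.obj (TopCat.of M)) _⦋n⦌) :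
    ModuleCat.of ℤ (ULift.{u} ℤ) ⟶ (chains M).X n :=
  SSet.ιChainComplex (R := ModuleCat.of ℤ (ULift.{u} ℤ)) _ s

lemma chainGen_d {n : ℕ} (s : (TopCat.toSSet.obj (TopCat.of M)) _⦋n + 1⦌) :
    chainGen s ≫ (chains M).d (n + 1) n =
      ∑ i : Fin (n + 2), (-1) ^ i.val •
        chainGen ((TopCat.toSSet.obj (TopCat.of M)).δ i s) :=
  SSet.ιChainComplex_d _ _ _

/-- The generator of the `0`-chains given by a point. -/
def pointChain (x : M) : (chains M).X 0 :=
  (chainGen ((TopCat.toSSetObj₀Equiv (X := TopCat.of M)).symm x)).hom ⟨1⟩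

/-- The class of a singular `1`-simplex. -/
def simplexClass (s : (TopCat.toSSet.obj (TopCat.of M)) _⦋1⦌) : ChainsModBoundaries M :=
  ((chains M).pOpcycles 1).hom ((chainGen s).hom ⟨1⟩)

open Classical in
/-- The class, modulo boundaries, of the path `γ : [0, 1] → M`. The values of `γ` outside of
`[0, 1]` are irrelevant; the class is `0` if `γ` is not continuous on `[0, 1]`. -/
def pathClass (γ : ℝ → M) : ChainsModBoundaries M :=
  if h : ContinuousOn γ (Icc 0 1) then simplexClass (curveSimplex γ h) else 0

lemma H1Incl_curveClass (γ : ℝ → M) (hγ : ContinuousOn γ (Icc 0 1)) (h01 : γ 0 = γ 1) :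
    H1Incl M (curveClass γ hγ h01) = pathClass γ := by
  rw [pathClass, dif_pos hγ]
  have h : (chains M).liftCycles (chainGen (curveSimplex γ hγ)) 0 (by simp)
      (curveSimplex_cycle γ hγ h01) ≫ (chains M).homologyπ 1 ≫ (chains M).homologyι 1 =
      chainGen (curveSimplex γ hγ) ≫ (chains M).pOpcycles 1 := by
    rw [HomologicalComplex.homology_π_ι, ← Category.assoc]
    congr 1
    exact HomologicalComplex.liftCycles_i ..
  exact congr(($h).hom ⟨1⟩)

lemma pathClass_congr {γ η : ℝ → M} (h : EqOn γ η (Icc 0 1)) : pathClass γ = pathClass η := by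
  by_cases hγ : ContinuousOn γ (Icc 0 1)
  · have hη : ContinuousOn η (Icc 0 1) := hγ.congr h.symm
    rw [pathClass, pathClass, dif_pos hγ, dif_pos hη]
    congr 1
    apply ((TopCat.of M).toSSetObjEquiv _).injective
    ext x
    exact h ⟨x.2.1 1, (mem_Icc_of_mem_stdSimplex x.2 1).2⟩
  · rw [pathClass, pathClass, dif_neg hγ, dif_neg fun hη ↦ hγ (hη.congr h)]

lemma δ_zero_curveSimplex (γ : ℝ → M) (hγ : ContinuousOn γ (Icc 0 1)) :
    (TopCat.toSSet.obj (TopCat.of M)).δ 0 (curveSimplex γ hγ) =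
      TopCat.toSSetObj₀Equiv.symm (γ 1) := by
  apply ((TopCat.of M).toSSetObjEquiv _).injective
  ext x
  obtain rfl := Subsingleton.elim x (stdSimplex.vertex (S := ℝ) (0 : Fin 1))
  have h0 : (stdSimplex.map (Fin.succAbove (0 : Fin 2))
      (stdSimplex.vertex (S := ℝ) (0 : Fin 1))).1 1 = 1 := by
    rw [stdSimplex.map_vertex]; simp
  change γ ((stdSimplex.map (Fin.succAbove (0 : Fin 2))
      (stdSimplex.vertex (S := ℝ) (0 : Fin 1))).1 1) = γ 1
  rw [h0]

lemma δ_one_curveSimplex (γ : ℝ → M) (hγ : ContinuousOn γ (Icc 0 1)) :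
    (TopCat.toSSet.obj (TopCat.of M)).δ 1 (curveSimplex γ hγ) =
      TopCat.toSSetObj₀Equiv.symm (γ 0) := by
  apply ((TopCat.of M).toSSetObjEquiv _).injective
  ext x
  obtain rfl := Subsingleton.elim x (stdSimplex.vertex (S := ℝ) (0 : Fin 1))
  have h1 : (stdSimplex.map (Fin.succAbove (1 : Fin 2))
      (stdSimplex.vertex (S := ℝ) (0 : Fin 1))).1 1 = 0 := by
    rw [stdSimplex.map_vertex]; simp
  change γ ((stdSimplex.map (Fin.succAbove (1 : Fin 2))
      (stdSimplex.vertex (S := ℝ) (0 : Fin 1))).1 1) = γ 0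
  rw [h1]

lemma bdry_pathClass {γ : ℝ → M} (hγ : ContinuousOn γ (Icc 0 1)) :
    bdry M (pathClass γ) = pointChain (γ 1) - pointChain (γ 0) := by
  rw [pathClass, dif_pos hγ]
  have h : chainGen (curveSimplex γ hγ) ≫ (chains M).pOpcycles 1 ≫ (chains M).fromOpcycles 1 0 =
      chainGen (TopCat.toSSetObj₀Equiv.symm (γ 1)) -
        chainGen (TopCat.toSSetObj₀Equiv.symm (γ 0)) := by
    rw [HomologicalComplex.p_fromOpcycles, chainGen_d, Fin.sum_univ_two, δ_zero_curveSimplex,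
      δ_one_curveSimplex]
    simp [sub_eq_add_neg]
  exact congr(($h).hom ⟨1⟩)

/-- Additivity of path classes along the sides of a singular triangle. This single relation yields
additivity under subdivision of a path (with `E = ℝ`), and homotopy invariance (with `E = ℝ²`). -/
lemma pathClass_triangle {E : Type*} [AddCommGroup E] [Module ℝ E] [TopologicalSpace E]
    [IsTopologicalAddGroup E] [ContinuousSMul ℝ E] {f : E → M} {S : Set E}
    (hf : ContinuousOn f S) (hS : Convex ℝ S) {p q r : E} (hp : p ∈ S) (hq : q ∈ S) (hr : r ∈ S) :
    pathClass (fun t : ℝ ↦ f (AffineMap.lineMap p q t)) +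
      pathClass (fun t : ℝ ↦ f (AffineMap.lineMap q r t)) =
      pathClass (fun t : ℝ ↦ f (AffineMap.lineMap p r t)) := by
  have hline : ∀ {a b : E}, a ∈ S → b ∈ S →
      ContinuousOn (fun t : ℝ ↦ f (AffineMap.lineMap a b t)) (Icc 0 1) := by
    intro a b ha hb
    refine hf.comp ?_ fun t ht ↦ ?_
    · have : Continuous fun t : ℝ ↦ AffineMap.lineMap a b t := AffineMap.lineMap_continuous
      exact this.continuousOn
    · exact hS.segment_subset ha hb (by rw [segment_eq_image_lineMap]; exact ⟨t, ht, rfl⟩)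
  let T : (TopCat.toSSet.obj (TopCat.of M)) _⦋2⦌ :=
    ((TopCat.of M).toSSetObjEquiv (Opposite.op ⦋2⦌)).symm
      ⟨fun x : stdSimplex ℝ (Fin 3) ↦ f (x.1 0 • p + x.1 1 • q + x.1 2 • r), by
        refine hf.comp_continuous ?_ fun x ↦ ?_
        · have h (i : Fin 3) : Continuous fun x : stdSimplex ℝ (Fin 3) ↦ x.1 i :=
            (continuous_apply i).comp continuous_subtype_val
          exact (((h 0).smul continuous_const).add ((h 1).smul continuous_const)).add
            ((h 2).smul continuous_const)
        · have := hS.sum_mem (t := Finset.univ) (w := x.1) (z := ![p, q, r])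
            (fun i _ ↦ x.2.1 i) x.2.2 (by intro i _; fin_cases i <;> assumption)
          simpa [Fin.sum_univ_three] using this⟩
  have key (i : Fin 3) (a b : E) (ha : a ∈ S) (hb : b ∈ S)
      (h : ∀ y : stdSimplex ℝ (Fin 2), (stdSimplex.map i.succAbove y).1 0 • p +
        (stdSimplex.map i.succAbove y).1 1 • q + (stdSimplex.map i.succAbove y).1 2 • r =
          y.1 0 • a + y.1 1 • b) :
      (TopCat.toSSet.obj (TopCat.of M)).δ i T = curveSimplex _ (hline ha hb) := by
    apply ((TopCat.of M).toSSetObjEquiv _).injective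
    ext y
    have hy : y.1 0 = 1 - y.1 1 := by
      have := y.2.2
      rw [Fin.sum_univ_two] at this
      linarith
    refine congrArg f ((h y).trans ?_)
    rw [hy, AffineMap.lineMap_apply_module]
    rfl
  have c (i : Fin 3) (y : stdSimplex ℝ (Fin 2)) (j : Fin 3) :
      (stdSimplex.map i.succAbove y).1 j = ∑ k : Fin 2, if i.succAbove k = j then y.1 k else 0 := by
    rw [← Finset.sum_filter]
    exact FunOnFinite.linearMap_apply_apply ..
  -- the coordinates of the three faces of the triangle
  have d0 : ∀ k j, ((0 : Fin 3).succAbove k = j) ↔ (k = 0 ∧ j = 1 ∨ k = 1 ∧ j = 2) := by decide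
  have d1 : ∀ k j, ((1 : Fin 3).succAbove k = j) ↔ (k = 0 ∧ j = 0 ∨ k = 1 ∧ j = 2) := by decide
  have d2 : ∀ k j, ((2 : Fin 3).succAbove k = j) ↔ (k = 0 ∧ j = 0 ∨ k = 1 ∧ j = 1) := by decide
  have k0 := key 0 q r hq hr (fun y ↦ by rw [c, c, c]; simp only [d0, Fin.sum_univ_two]; simp)
  have k1 := key 1 p r hp hr (fun y ↦ by rw [c, c, c]; simp only [d1, Fin.sum_univ_two]; simp)
  have k2 := key 2 p q hp hq (fun y ↦ by rw [c, c, c]; simp only [d2, Fin.sum_univ_two]; simp)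
  have h : chainGen (curveSimplex _ (hline hq hr)) ≫ (chains M).pOpcycles 1 -
      chainGen (curveSimplex _ (hline hp hr)) ≫ (chains M).pOpcycles 1 +
      chainGen (curveSimplex _ (hline hp hq)) ≫ (chains M).pOpcycles 1 = 0 := by
    have h' : (chainGen T ≫ (chains M).d 2 1) ≫ (chains M).pOpcycles 1 = 0 := by
      rw [Category.assoc, HomologicalComplex.d_pOpcycles, Limits.comp_zero]
    rw [← h', chainGen_d, Fin.sum_univ_three, k0, k1, k2]
    simp [Preadditive.add_comp, sub_eq_add_neg]
  have h1 : simplexClass (curveSimplex _ (hline hq hr)) -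
      simplexClass (curveSimplex _ (hline hp hr)) +
      simplexClass (curveSimplex _ (hline hp hq)) = 0 := congr(($h).hom ⟨1⟩)
  simp only [pathClass, dif_pos (hline hp hq), dif_pos (hline hq hr), dif_pos (hline hp hr)]
  rw [← sub_eq_zero, ← h1]
  abel

/-- The morphism from `ℤ` to a `ℤ`-module sending `1` to a given element. -/
def homOfElement (T : ModuleCat.{u} ℤ) (t : T) : ModuleCat.of ℤ (ULift.{u} ℤ) ⟶ T :=
  ModuleCat.ofHom (Y := T)
    { toFun := fun n ↦ n.down • t
      map_add' := fun a b ↦ add_zsmul t a.down b.down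
      map_smul' := fun a b ↦
        (mul_zsmul t a b.down).trans (int_smul_eq_zsmul _ a (b.down • t)).symm }

lemma homOfElement_apply_one (T : ModuleCat.{u} ℤ) (t : T) : (homOfElement T t).hom ⟨1⟩ = t :=
  one_smul ℤ t

lemma hom_ext_one {T : ModuleCat.{u} ℤ} {f g : ModuleCat.of ℤ (ULift.{u} ℤ) ⟶ T}
    (h : f.hom ⟨1⟩ = g.hom ⟨1⟩) : f = g := by
  refine ModuleCat.hom_ext (LinearMap.ext fun n ↦ ?_)
  have hn : n = n.down • (⟨1⟩ : ULift.{u} ℤ) := by ext; simp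
  rw [hn, map_zsmul, map_zsmul, h]

/-- To prove that every `1`-cycle lies in a subgroup `S`, it is enough to know that, modulo `S`,
the class of every path only depends on the end points, as the increment of a function `Λ`. -/
lemma ker_bdry_le (S : Submodule ℤ (ChainsModBoundaries M)) (Λ : M → ChainsModBoundaries M)
    (h : ∀ γ : ℝ → M, ContinuousOn γ (Icc 0 1) → pathClass γ - (Λ (γ 1) - Λ (γ 0)) ∈ S) :
    LinearMap.ker (bdry M) ≤ S := by
  let R := ModuleCat.of ℤ (ULift.{u} ℤ)
  let T : ModuleCat.{u} ℤ :=
    @ModuleCat.of ℤ _ (ChainsModBoundaries M ⧸ S) _ (Submodule.Quotient.module S)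
  let φ (s : (TopCat.toSSet.obj (TopCat.of M)) _⦋0⦌) : R ⟶ T :=
    homOfElement T (S.mkQ (Λ (TopCat.toSSetObj₀Equiv s)))
  let Λ' : (chains M).X 0 ⟶ T := Limits.Cofan.IsColimit.desc
    (SSet.isColimitChainComplexXCofan (TopCat.toSSet.obj (TopCat.of M)) R 0) φ
  have hΛ (x : M) : Λ'.hom (pointChain x) = S.mkQ (Λ x) := by
    have h1 : chainGen (TopCat.toSSetObj₀Equiv.symm x) ≫ Λ' = φ (TopCat.toSSetObj₀Equiv.symm x) :=
      Limits.Cofan.IsColimit.fac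
        (SSet.isColimitChainComplexXCofan (TopCat.toSSet.obj (TopCat.of M)) R 0) φ _
    have h2 : Λ'.hom (pointChain x) = (φ (TopCat.toSSetObj₀Equiv.symm x)).hom ⟨1⟩ :=
      congr(($h1).hom ⟨1⟩)
    rw [h2]
    exact homOfElement_apply_one T _
  let p : (chains M).opcycles 1 ⟶ T :=
    @ModuleCat.ofHom ℤ _ _ _ _ _ _ (Submodule.Quotient.module S) S.mkQ
  have key : (chains M).pOpcycles 1 ≫ p =
      (chains M).pOpcycles 1 ≫ (chains M).fromOpcycles 1 0 ≫ Λ' := by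
    refine SSet.chainComplex_hom_ext (X := TopCat.toSSet.obj (TopCat.of M)) (R := R)
      fun s ↦ hom_ext_one ?_
    -- every singular `1`-simplex is the simplex of a path
    let g := (TopCat.of M).toSSetObjEquiv _ s
    let γ : ℝ → M := fun t ↦ g (stdSimplexHomeomorphUnitInterval.symm
      (projIcc (0 : ℝ) 1 zero_le_one t))
    have hγ : Continuous γ := by fun_prop
    have hs : curveSimplex γ hγ.continuousOn = s := by
      apply ((TopCat.of M).toSSetObjEquiv _).injective
      ext y
      change γ (y.1 1) = g y
      change g _ = g y
      congr 1
      rw [Homeomorph.symm_apply_eq, projIcc_of_mem zero_le_one (mem_Icc_of_mem_stdSimplex y.2 1)]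
      rfl
    have h1 := h γ hγ.continuousOn
    have h2 := bdry_pathClass hγ.continuousOn
    have h3 : pathClass γ = simplexClass s := by
      rw [pathClass, dif_pos hγ.continuousOn, hs]
    rw [h3] at h1 h2
    rw [← Submodule.Quotient.mk_eq_zero, Submodule.Quotient.mk_sub, sub_eq_zero] at h1
    change S.mkQ (simplexClass s) = Λ'.hom (bdry M (simplexClass s))
    rw [h2, map_sub, hΛ, hΛ]
    exact h1
  rw [cancel_epi] at key
  intro q hq
  have h1 := congr(($key).hom q)
  have h2 : S.mkQ q = Λ'.hom (bdry M q) := h1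
  rw [LinearMap.mem_ker.1 hq, map_zero] at h2
  exact (Submodule.Quotient.mk_eq_zero S).1 h2

end PathClass

section Subpath

variable {M : Type u} [TopologicalSpace M]

/-- The class, modulo boundaries, of the restriction of `γ` to the interval between `a` and `b`. -/
def subpathClass (γ : ℝ → M) (a b : ℝ) : ChainsModBoundaries M :=
  pathClass fun t : ℝ ↦ γ (AffineMap.lineMap a b t)

lemma lineMap_zero_one (t : ℝ) : AffineMap.lineMap (0 : ℝ) 1 t = t := by
  simp [AffineMap.lineMap_apply_module]

@[simp] lemma subpathClass_zero_one (γ : ℝ → M) : subpathClass γ 0 1 = pathClass γ := by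
  simp only [subpathClass, lineMap_zero_one]

lemma subpathClass_add {γ : ℝ → M} {a b c : ℝ} (hab : a ≤ b) (hbc : b ≤ c)
    (hγ : ContinuousOn γ (Icc a c)) :
    subpathClass γ a b + subpathClass γ b c = subpathClass γ a c :=
  pathClass_triangle hγ (convex_Icc a c) ⟨le_rfl, hab.trans hbc⟩ ⟨hab, hbc⟩ ⟨hab.trans hbc, le_rfl⟩

@[simp] lemma pathClass_const (x : M) : pathClass (fun _ ↦ x) = 0 := by
  have h := pathClass_triangle (f := fun _ : ℝ ↦ x) continuousOn_const convex_univ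
    (mem_univ 0) (mem_univ 0) (mem_univ 0)
  simpa using h

lemma pathClass_reverse {γ : ℝ → M} (hγ : ContinuousOn γ (Icc 0 1)) :
    pathClass (fun t ↦ γ (1 - t)) = -pathClass γ := by
  have h := pathClass_triangle hγ (convex_Icc 0 1) (p := 0) (q := 1) (r := 0) (by simp) (by simp)
    (by simp)
  simp only [AffineMap.lineMap_apply_module] at h
  simp at h
  exact eq_neg_of_add_eq_zero_right h

end Subpath

/-! ### Piecewise smooth paths -/

section SmoothReach

variable {m : ℕ} {M : Type u} [TopologicalSpace M] [ChartedSpace (EuclideanSpace ℝ (Fin m)) M]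

variable (m) in
/-- `SmoothReach m x y q` means that some concatenation of finitely many smooth paths goes from
`x` to `y` and has class `q` modulo boundaries. -/
inductive SmoothReach : M → M → ChainsModBoundaries M → Prop where
  /-- The constant path. -/
  | refl (x : M) : SmoothReach x x 0
  /-- Prolongation by a smooth path. -/
  | step {x : M} {q : ChainsModBoundaries M} (γ : ℝ → M) (h : SmoothReach x (γ 0) q)
      (hγ : ContMDiffOn 𝓘(ℝ) (𝓡 m) ∞ γ (Icc 0 1)) : SmoothReach x (γ 1) (q + pathClass γ)

lemma SmoothReach.of_contMDiffOn {γ : ℝ → M} (hγ : ContMDiffOn 𝓘(ℝ) (𝓡 m) ∞ γ (Icc 0 1)) :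
    SmoothReach m (γ 0) (γ 1) (pathClass γ) := by
  simpa using SmoothReach.step γ (SmoothReach.refl _) hγ

lemma SmoothReach.trans {x y z : M} {q r : ChainsModBoundaries M} (h : SmoothReach m x y q)
    (h' : SmoothReach m y z r) : SmoothReach m x z (q + r) := by
  induction h' with
  | refl => simpa using h
  | step γ _ hγ ih => rw [← add_assoc]; exact .step γ ih hγ

lemma SmoothReach.symm {x y : M} {q : ChainsModBoundaries M} (h : SmoothReach m x y q) :
    SmoothReach m y x (-q) := by
  induction h with
  | refl => simpa using SmoothReach.refl _
  | step γ _ hγ ih =>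
    have hr : ContMDiffOn 𝓘(ℝ) (𝓡 m) ∞ (fun t : ℝ ↦ γ (1 - t)) (Icc 0 1) := by
      refine hγ.comp (t := Icc 0 1) (f := fun t : ℝ ↦ 1 - t) ?_ fun t ht ↦ ?_
      · exact (contDiff_const.sub contDiff_id).contMDiff.contMDiffOn
      · constructor <;> linarith [ht.1, ht.2]
    have := (SmoothReach.of_contMDiffOn hr).trans (by simpa using ih)
    rw [pathClass_reverse hγ.continuousOn] at this
    simpa [add_comm] using this

variable (m) in
/-- `γ` is piecewise smooth on `[0, 1]`. -/
def PiecewiseSmooth (γ : ℝ → M) : Prop :=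
  ∃ (n : ℕ) (t : ℕ → ℝ), t 0 = 0 ∧ t n = 1 ∧ Monotone t ∧
    ∀ i < n, ContMDiffOn 𝓘(ℝ) (𝓡 m) ∞ γ (Icc (t i) (t (i + 1)))

/-- A chain of smooth paths can be concatenated to a piecewise smooth path on `[0, 1]`. -/
lemma SmoothReach.exists_path {x y : M} {q : ChainsModBoundaries M} (h : SmoothReach m x y q) :
    ∃ γ : ℝ → M, ContinuousOn γ (Icc 0 1) ∧ γ 0 = x ∧ γ 1 = y ∧ pathClass γ = q ∧
      PiecewiseSmooth m γ := by
  induction h with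
  | refl =>
    refine ⟨fun _ ↦ x, continuousOn_const, rfl, rfl, pathClass_const x, 1,
      fun i ↦ if i = 0 then 0 else 1, by simp, by simp, ?_, fun _ _ ↦ contMDiffOn_const⟩
    intro i j hij
    dsimp only
    split_ifs <;> first | omega | norm_num
  | step γ _ hγ ih =>
    obtain ⟨η, hη, h0, h1, hq, n, t, t0, tn, ht, hs⟩ := ih
    let ζ : ℝ → M := fun s ↦ if s ≤ 1 / 2 then η (2 * s) else γ (2 * s - 1)
    have hl : ∀ s, s ≤ 1 / 2 → ζ s = η (2 * s) := fun s hs ↦ if_pos hs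
    have hr : ∀ s, 1 / 2 ≤ s → ζ s = γ (2 * s - 1) := by
      intro s hs
      rcases hs.eq_or_lt with rfl | hs
      · rw [hl _ le_rfl]; norm_num [h1]
      · exact if_neg (not_le.2 hs)
    have hcl : ContinuousOn ζ (Icc 0 (1 / 2)) := by
      refine ContinuousOn.congr (f := fun s ↦ η (2 * s)) ?_ fun s hs ↦ hl s hs.2
      refine hη.comp (by fun_prop) fun s hs ↦ ?_
      constructor <;> linarith [hs.1, hs.2]
    have hsr : ContMDiffOn 𝓘(ℝ) (𝓡 m) ∞ ζ (Icc (1 / 2) 1) := by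
      refine ContMDiffOn.congr (f := fun s ↦ γ (2 * s - 1)) ?_ fun s hs ↦ hr s hs.1
      refine hγ.comp (t := Icc 0 1) (f := fun s : ℝ ↦ 2 * s - 1) ?_ fun s hs ↦ ?_
      · exact ((contDiff_const.mul contDiff_id).sub contDiff_const).contMDiff.contMDiffOn
      · constructor <;> linarith [hs.1, hs.2]
    have hc : ContinuousOn ζ (Icc 0 1) := by
      rw [← Icc_union_Icc_eq_Icc (a := (0 : ℝ)) (b := 1 / 2) (c := 1) (by norm_num) (by norm_num)]
      exact hcl.union_of_isClosed hsr.continuousOn isClosed_Icc isClosed_Icc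
    have h1' : ζ 1 = γ 1 := by rw [hr 1 (by norm_num)]; norm_num
    refine ⟨ζ, hc, by rw [hl 0 (by norm_num)]; simpa using h0, h1', ?_, n + 1,
      fun i ↦ if i ≤ n then t i / 2 else 1, by simp [t0], by simp, ?_, ?_⟩
    · rw [← subpathClass_zero_one,
        ← subpathClass_add (b := 1 / 2) (by norm_num) (by norm_num) hc]
      congr 1
      · rw [← hq]
        refine pathClass_congr fun s hs ↦ ?_
        have e : AffineMap.lineMap (0 : ℝ) (1 / 2) s = s / 2 := by
          simp [AffineMap.lineMap_apply_module]; ring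
        rw [e, hl _ (by linarith [hs.2])]
        ring_nf
      · refine pathClass_congr fun s hs ↦ ?_
        have e : AffineMap.lineMap (1 / 2 : ℝ) 1 s = (1 + s) / 2 := by
          simp [AffineMap.lineMap_apply_module]; ring
        rw [e, hr _ (by linarith [hs.1])]
        ring_nf
    · refine monotone_nat_of_le_succ fun i ↦ ?_
      have hi := ht (Nat.le_succ i)
      split_ifs with h₁ h₂ h₂
      · gcongr
      · have := ht h₁
        linarith
      · omega
      · exact le_rfl
    · intro i hi
      dsimp only
      rw [if_pos (by omega)]
      split_ifs with h₂
      · have b0 : 0 ≤ t i := t0 ▸ ht (Nat.zero_le i)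
        have b1 : t (i + 1) ≤ 1 := tn ▸ ht h₂
        refine ContMDiffOn.congr (f := fun s ↦ η (2 * s)) ?_
          fun s hs ↦ hl s (by linarith [hs.2])
        refine (hs i (by omega)).comp (t := Icc (t i) (t (i + 1))) (f := fun s : ℝ ↦ 2 * s) ?_
          fun s hs ↦ ?_
        · exact (contDiff_const.mul contDiff_id).contMDiff.contMDiffOn
        · constructor <;> linarith [hs.1, hs.2]
      · obtain rfl : i = n := by omega
        rw [tn]
        exact hsr

variable [IsManifold (𝓡 m) ∞ M]

variable (m) in
/-- Every point `x` has an open neighborhood `U` on which path classes have a primitive `L`, whose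
values are classes of piecewise smooth paths from `x`. In the chart ball around `x` that is taken
for `U`, the primitive is the class of the segment from `x`, and a path in `U` is homotopic with
fixed end points to a concatenation of two segments through `x` because `U` is star-shaped. -/
lemma exists_local_primitive (x : M) :
    ∃ (U : Set M) (L : M → ChainsModBoundaries M), IsOpen U ∧ x ∈ U ∧
      (∀ y ∈ U, SmoothReach m x y (L y)) ∧
      ∀ (γ : ℝ → M) (a b : ℝ), a ≤ b → ContinuousOn γ (Icc a b) → MapsTo γ (Icc a b) U →
        subpathClass γ a b = L (γ b) - L (γ a) := by
  let e := chartAt (EuclideanSpace ℝ (Fin m)) x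
  have hx : x ∈ e.source := mem_chart_source _ x
  obtain ⟨r, r0, hr⟩ := Metric.isOpen_iff.1 e.open_target (e x) (e.map_source hx)
  let c := e x
  have hc : c ∈ Metric.ball c r := Metric.mem_ball_self r0
  have hsymm : ContMDiffOn (𝓡 m) (𝓡 m) ∞ e.symm e.target := contMDiffOn_chart_symm
  refine ⟨e.source ∩ e ⁻¹' Metric.ball c r,
    fun y ↦ pathClass fun t ↦ e.symm (AffineMap.lineMap c (e y) t),
    e.isOpen_inter_preimage Metric.isOpen_ball, ⟨hx, hc⟩, ?_, ?_⟩
  · intro y hy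
    have hs : ContMDiffOn 𝓘(ℝ) (𝓡 m) ∞ (fun t : ℝ ↦ e.symm (AffineMap.lineMap c (e y) t))
        (Icc 0 1) := by
      refine hsymm.comp (I' := (𝓡 m)) (f := fun t : ℝ ↦ AffineMap.lineMap c (e y) t) ?_
        fun t ht ↦ ?_
      · have : ContDiff ℝ ∞ (fun t : ℝ ↦ AffineMap.lineMap c (e y) t) := by
          simp only [AffineMap.lineMap_apply_module]
          fun_prop
        exact this.contMDiff.contMDiffOn
      · exact hr ((convex_ball c r).segment_subset hc hy.2
          (by rw [segment_eq_image_lineMap]; exact ⟨t, ht, rfl⟩))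
    have := SmoothReach.of_contMDiffOn hs
    simpa [c, e.left_inv hx, e.left_inv hy.1] using this
  · intro γ a b hab hγ hU
    let f : ℝ × ℝ → M := fun p ↦ e.symm (AffineMap.lineMap c (e (γ p.2)) p.1)
    have hf : ContinuousOn f (Icc 0 1 ×ˢ Icc a b) := by
      refine e.continuousOn_symm.comp ?_ fun p hp ↦ ?_
      · have h1 : ContinuousOn (fun p : ℝ × ℝ ↦ e (γ p.2)) (Icc 0 1 ×ˢ Icc a b) :=
          (e.continuousOn.comp hγ fun t ht ↦ (hU ht).1).comp continuousOn_snd fun p hp ↦ hp.2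
        simp only [AffineMap.lineMap_apply_module]
        exact ((continuousOn_const.sub continuousOn_fst).smul continuousOn_const).add
          (continuousOn_fst.smul h1)
      · exact hr ((convex_ball c r).segment_subset hc (hU hp.2).2
          (by rw [segment_eq_image_lineMap]; exact ⟨p.1, hp.1, rfl⟩))
    have hS : Convex ℝ (Icc (0 : ℝ) 1 ×ˢ Icc a b) := (convex_Icc 0 1).prod (convex_Icc a b)
    have l0 : (0 : ℝ) ∈ Icc (0 : ℝ) 1 := by simp
    have l1 : (1 : ℝ) ∈ Icc (0 : ℝ) 1 := by simp
    have la : a ∈ Icc a b := ⟨le_rfl, hab⟩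
    have lb : b ∈ Icc a b := ⟨hab, le_rfl⟩
    -- the diagonal of the rectangle is compared with the two pairs of sides
    have h1 := pathClass_triangle hf hS (p := (0, a)) (q := (1, a)) (r := (1, b))
      ⟨l0, la⟩ ⟨l1, la⟩ ⟨l1, lb⟩
    have h2 := pathClass_triangle hf hS (p := (0, a)) (q := (0, b)) (r := (1, b))
      ⟨l0, la⟩ ⟨l0, lb⟩ ⟨l1, lb⟩
    have fst : ∀ (p q : ℝ × ℝ) (t : ℝ),
        (AffineMap.lineMap p q t).1 = AffineMap.lineMap p.1 q.1 t := fun p q t ↦ by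
      simp [AffineMap.lineMap_apply_module]
    have snd : ∀ (p q : ℝ × ℝ) (t : ℝ),
        (AffineMap.lineMap p q t).2 = AffineMap.lineMap p.2 q.2 t := fun p q t ↦ by
      simp [AffineMap.lineMap_apply_module]
    simp only [f, fst, snd, AffineMap.lineMap_same, AffineMap.const_apply,
      AffineMap.lineMap_apply_zero, AffineMap.lineMap_apply_one, lineMap_zero_one, pathClass_const, zero_add] at h1 h2
    have h3 : pathClass (fun t ↦ e.symm (e (γ (AffineMap.lineMap a b t)))) =
        subpathClass γ a b := by
      refine pathClass_congr fun t ht ↦ e.left_inv (hU ?_).1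
      rw [← segment_eq_Icc hab, segment_eq_image_lineMap]
      exact ⟨t, ht, rfl⟩
    rw [h3] at h1
    rw [eq_sub_iff_add_eq', h1, ← h2]

variable (m) in
lemma exists_smoothReach [ConnectedSpace M] (x y : M) : ∃ q, SmoothReach m x y q := by
  have key : IsClopen {y | ∃ q, SmoothReach m x y q} := by
    constructor
    · rw [← isOpen_compl_iff, isOpen_iff_mem_nhds]
      intro y hy
      obtain ⟨U, L, hU, hyU, hL, -⟩ := exists_local_primitive m y
      filter_upwards [hU.mem_nhds hyU] with z hz ⟨q, hq⟩
      exact hy ⟨_, hq.trans (hL z hz).symm⟩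
    · rw [isOpen_iff_mem_nhds]
      rintro y ⟨q, hq⟩
      obtain ⟨U, L, hU, hyU, hL, -⟩ := exists_local_primitive m y
      filter_upwards [hU.mem_nhds hyU] with z hz
      exact ⟨_, hq.trans (hL z hz)⟩
  exact eq_univ_iff_forall.1 (key.eq_univ ⟨x, 0, .refl x⟩) y

end SmoothReach

/-! ### Finite covers with primitives, and finite generation of the homology -/

lemma _root_.Module.Finite.of_injective_of_range_le {R A B : Type*} [Ring R] [IsNoetherianRing R]
    [AddCommGroup A] [Module R A] [AddCommGroup B] [Module R B] {f : A →ₗ[R] B}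
    (hf : Function.Injective f) {S : Submodule R B} (hS : S.FG) (h : LinearMap.range f ≤ S) :
    Module.Finite R A := by
  have : IsNoetherian R S := isNoetherian_of_fg_of_noetherian _ hS
  exact Module.Finite.of_injective (f.codRestrict S fun x ↦ h (LinearMap.mem_range_self f x))
    fun x y hxy ↦ hf (congrArg Subtype.val hxy)

section Cover

variable (m : ℕ) (M : Type u) [TopologicalSpace M] [ChartedSpace (EuclideanSpace ℝ (Fin m)) M]

/-- A finite open cover of `M` with a primitive of path classes on each of its members, normalized
by `SmoothReach` from a common base point, such that the differences of the primitives on the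
overlaps of the cover take finitely many values. -/
structure PrimitiveCover where
  /-- The index set of the cover. -/
  ι : Type u
  finite : Finite ι
  /-- The members of the cover. -/
  V : ι → Set M
  isOpen : ∀ i, IsOpen (V i)
  cover : ∀ x, ∃ i, x ∈ V i
  /-- The base point. -/
  base : M
  /-- The primitive on a member of the cover. -/
  L : ι → M → ChainsModBoundaries M
  reach : ∀ i, ∀ y ∈ V i, SmoothReach m base y (L i y)
  primitive : ∀ (i : ι) (γ : ℝ → M) (a b : ℝ), a ≤ b → ContinuousOn γ (Icc a b) →
    MapsTo γ (Icc a b) (V i) → subpathClass γ a b = L i (γ b) - L i (γ a)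
  finite_diff : {d | ∃ i j, ∃ y ∈ V i ∩ V j, d = L i y - L j y}.Finite

/-- On a compact manifold there is a `PrimitiveCover`: the difference of two local primitives is
locally constant on the overlap of their domains, so that it takes finitely many values after the
domains have been shrunk. -/
lemma nonempty_primitiveCover [IsManifold (𝓡 m) ∞ M] [T2Space M] [CompactSpace M]
    [ConnectedSpace M] : Nonempty (PrimitiveCover m M) := by
  have : LocallyPathConnectedSpace M :=
    ChartedSpace.locallyPathConnectedSpace (EuclideanSpace ℝ (Fin m)) M
  choose U L hU hxU hL hprim using exists_local_primitive m (M := M)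
  obtain ⟨x₀⟩ : Nonempty M := inferInstance
  choose q hq using exists_smoothReach m x₀
  have hK : ∀ x, ∃ K ∈ 𝓝 x, IsClosed K ∧ K ⊆ U x := fun x ↦
    exists_mem_nhds_isClosed_subset ((hU x).mem_nhds (hxU x))
  choose K hKn hKc hKU using hK
  obtain ⟨t, ht⟩ := CompactSpace.elim_nhds_subcover (fun x ↦ interior (K x))
    fun x ↦ interior_mem_nhds.2 (hKn x)
  have hVU : ∀ x, interior (K x) ⊆ U x := fun x ↦ interior_subset.trans (hKU x)
  refine ⟨{
    ι := t
    finite := inferInstance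
    V := fun i ↦ interior (K i)
    isOpen := fun i ↦ isOpen_interior
    cover := fun x ↦ ?_
    base := x₀
    L := fun i y ↦ q i + L i y
    reach := fun i y hy ↦ (hq i).trans (hL i y (hVU i hy))
    primitive := fun i γ a b hab hγ hV ↦ ?_
    finite_diff := ?_ }⟩
  · have hx : x ∈ ⋃ y ∈ t, interior (K y) := ht ▸ mem_univ x
    simp only [mem_iUnion] at hx
    obtain ⟨y, hy, hxy⟩ := hx
    exact ⟨⟨y, hy⟩, hxy⟩
  · rw [hprim i γ a b hab hγ fun s hs ↦ hVU i (hV hs)]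
    abel
  · have key (x y : M) : ((fun z ↦ (q x + L x z) - (q y + L y z)) '' (K x ∩ K y)).Finite := by
      have hc : IsCompact (K x ∩ K y) := ((hKc x).inter (hKc y)).isCompact
      refine hc.induction_on (p := fun s ↦
        ((fun z ↦ (q x + L x z) - (q y + L y z)) '' s).Finite) (by simp)
        (fun s t hst h ↦ h.subset (image_mono hst))
        (fun s t hs ht ↦ by rw [image_union]; exact hs.union ht) fun z hz ↦ ?_
      have hn : U x ∩ U y ∈ 𝓝 z :=
        ((hU x).inter (hU y)).mem_nhds ⟨hKU x hz.1, hKU y hz.2⟩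
      obtain ⟨W, ⟨hW, hWp⟩, hWU⟩ := (path_connected_basis z).mem_iff.1 hn
      refine ⟨W, nhdsWithin_le_nhds hW,
        (finite_singleton ((q x + L x z) - (q y + L y z))).subset ?_⟩
      rintro _ ⟨w, hw, rfl⟩
      obtain ⟨γ, hγ⟩ := hWp.joinedIn z (mem_of_mem_nhds hW) w hw
      -- both primitives have the same increment along a path in the overlap
      have hmaps : MapsTo γ.extend (Icc 0 1) (U x ∩ U y) := fun s _ ↦ hWU (hγ _)
      have h1 := hprim x γ.extend 0 1 zero_le_one γ.continuous_extend.continuousOn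
        fun s hs ↦ (hmaps hs).1
      have h2 := hprim y γ.extend 0 1 zero_le_one γ.continuous_extend.continuousOn
        fun s hs ↦ (hmaps hs).2
      rw [h1] at h2
      simp only [Path.extend_zero, Path.extend_one] at h2
      rw [mem_singleton_iff]
      have e : L x w - L y w = L x z - L y z := by
        rw [sub_eq_sub_iff_add_eq_add] at h2 ⊢
        rw [h2]
        abel
      calc (q x + L x w) - (q y + L y w) = (q x - q y) + (L x w - L y w) := by abel
        _ = _ := by rw [e]; abel
    refine (finite_iUnion fun i : t ↦ finite_iUnion fun j : t ↦ key i j).subset ?_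
    rintro _ ⟨i, j, y, hy, rfl⟩
    exact mem_iUnion.2 ⟨i, mem_iUnion.2 ⟨j, y, ⟨interior_subset hy.1, interior_subset hy.2⟩, rfl⟩⟩

namespace PrimitiveCover

variable {m M} (C : PrimitiveCover m M)

/-- The finitely many differences of the primitives on overlaps. -/
def diffs : Set (ChainsModBoundaries M) :=
  {d | ∃ i j, ∃ y ∈ C.V i ∩ C.V j, d = C.L i y - C.L j y}

/-- `C.Decomposes γ a b N`: the class of `γ` on `[a, b]` is the increment of the primitives up to
a sum of `N` of their differences. -/
def Decomposes (γ : ℝ → M) (a b : ℝ) (N : ℕ) : Prop :=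
  ∃ i j, γ a ∈ C.V i ∧ γ b ∈ C.V j ∧ ∃ l : List (ChainsModBoundaries M), l.length = N ∧
    (∀ d ∈ l, d ∈ C.diffs) ∧ subpathClass γ a b = C.L j (γ b) - C.L i (γ a) + l.sum

variable {C}

lemma Decomposes.of_mapsTo {γ : ℝ → M} {a b : ℝ} (hab : a ≤ b) (hγ : ContinuousOn γ (Icc a b))
    {i : C.ι} (h : MapsTo γ (Icc a b) (C.V i)) : C.Decomposes γ a b 0 :=
  ⟨i, i, h ⟨le_rfl, hab⟩, h ⟨hab, le_rfl⟩, [], rfl, by simp,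
    by rw [C.primitive i γ a b hab hγ h]; simp⟩

lemma Decomposes.trans {γ : ℝ → M} {a b c : ℝ} {N N' : ℕ} (hab : a ≤ b) (hbc : b ≤ c)
    (hγ : ContinuousOn γ (Icc a c)) (h : C.Decomposes γ a b N) (h' : C.Decomposes γ b c N') :
    C.Decomposes γ a c (N + N' + 1) := by
  obtain ⟨i, j, hi, hj, l, hl, hd, e⟩ := h
  obtain ⟨i', j', hi', hj', l', hl', hd', e'⟩ := h'
  refine ⟨i, j', hi, hj', (C.L j (γ b) - C.L i' (γ b)) :: (l ++ l'), by simp [hl, hl'], ?_, ?_⟩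
  · intro d hd₀
    rcases List.mem_cons.1 hd₀ with rfl | hd₀
    · exact ⟨j, i', γ b, ⟨hj, hi'⟩, rfl⟩
    · rcases List.mem_append.1 hd₀ with h | h
      exacts [hd d h, hd' d h]
  · rw [← subpathClass_add hab hbc hγ, e, e', List.sum_cons, List.sum_append]
    abel

variable (C)

lemma exists_decomposes {γ : ℝ → M} (hγ : ContinuousOn γ (Icc 0 1)) :
    ∃ N, C.Decomposes γ 0 1 N := by
  have hγ' : Continuous fun s : Icc (0 : ℝ) 1 ↦ γ s := continuousOn_iff_continuous_domRestrict.1 hγ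
  obtain ⟨t, t0, ht, ⟨n, hn⟩, hc⟩ := exists_monotone_Icc_subset_open_cover_Icc
    (zero_le_one (α := ℝ)) (c := fun i ↦ (fun s : Icc (0 : ℝ) 1 ↦ γ s) ⁻¹' C.V i)
    (fun i ↦ (C.isOpen i).preimage hγ') (fun s _ ↦ mem_iUnion.2 (C.cover (γ s)))
  have key (k : ℕ) : ∃ N, C.Decomposes γ 0 (t k) N := by
    have hsub (k : ℕ) : Icc (0 : ℝ) (t k) ⊆ Icc 0 1 := Icc_subset_Icc_right (t k).2.2
    induction k with
    | zero =>
      obtain ⟨i, hi⟩ := C.cover (γ 0)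
      refine ⟨0, .of_mapsTo (i := i) t0.ge (hγ.mono (hsub 0)) fun s hs ↦ ?_⟩
      rw [t0, Icc_self, mem_singleton_iff] at hs
      rwa [hs]
    | succ k ih =>
      obtain ⟨N, hN⟩ := ih
      obtain ⟨i, hi⟩ := hc k
      have hk : (t k : ℝ) ≤ t (k + 1) := ht (Nat.le_succ k)
      refine ⟨N + 0 + 1, hN.trans (t k).2.1 hk (hγ.mono (hsub _)) (.of_mapsTo (i := i) hk
        (hγ.mono (Icc_subset_Icc (t k).2.1 (t (k + 1)).2.2)) fun s hs ↦ ?_)⟩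
      exact hi (a := ⟨s, (t k).2.1.trans hs.1, hs.2.trans (t (k + 1)).2.2⟩) ⟨hs.1, hs.2⟩
  have := key n
  rwa [hn n le_rfl] at this

/-- A closed path that decomposes with `N` differences is a sum of `N + 1` differences. -/
lemma Decomposes.exists_list {γ : ℝ → M} {N : ℕ} (h : C.Decomposes γ 0 1 N) (h01 : γ 0 = γ 1) :
    ∃ l : List (ChainsModBoundaries M), l.length = N + 1 ∧ (∀ d ∈ l, d ∈ C.diffs) ∧
      pathClass γ = l.sum := by
  obtain ⟨i, j, hi, hj, l, hl, hd, e⟩ := h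
  refine ⟨(C.L j (γ 1) - C.L i (γ 1)) :: l, by simp [hl], ?_, ?_⟩
  · intro d hd₀
    rcases List.mem_cons.1 hd₀ with rfl | hd₀
    · exact ⟨j, i, γ 1, ⟨hj, h01 ▸ hi⟩, rfl⟩
    · exact hd d hd₀
  · rw [← subpathClass_zero_one, e, List.sum_cons, h01]

lemma ker_bdry_le_span : LinearMap.ker (bdry M) ≤ Submodule.span ℤ C.diffs := by
  -- all primitives agree modulo the differences, so any choice of one at each point will do
  choose idx hidx using C.cover
  refine ker_bdry_le _ (fun x ↦ C.L (idx x) x) fun γ hγ ↦ ?_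
  obtain ⟨N, i, j, hi, hj, l, -, hd, e⟩ := C.exists_decomposes hγ
  rw [subpathClass_zero_one] at e
  have h0 : C.L i (γ 0) - C.L (idx (γ 0)) (γ 0) ∈ Submodule.span ℤ C.diffs :=
    Submodule.subset_span ⟨i, _, γ 0, ⟨hi, hidx _⟩, rfl⟩
  have h1 : C.L j (γ 1) - C.L (idx (γ 1)) (γ 1) ∈ Submodule.span ℤ C.diffs :=
    Submodule.subset_span ⟨j, _, γ 1, ⟨hj, hidx _⟩, rfl⟩
  have hl : l.sum ∈ Submodule.span ℤ C.diffs :=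
    list_sum_mem fun d hd' ↦ Submodule.subset_span (hd d hd')
  have := add_mem (sub_mem h1 h0) hl
  rw [e]
  convert this using 1
  abel

/-- Every class of `H₁(M, ℤ)` is the class of a piecewise smooth loop. -/
lemma smoothReach_of_mem_ker {q : ChainsModBoundaries M} (hq : q ∈ LinearMap.ker (bdry M)) :
    SmoothReach m C.base C.base q := by
  let S : AddSubgroup (ChainsModBoundaries M) :=
    { carrier := {q | SmoothReach m C.base C.base q}
      add_mem' := fun h h' ↦ SmoothReach.trans h h'
      zero_mem' := .refl _
      neg_mem' := fun h ↦ SmoothReach.symm h }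
  have h := C.ker_bdry_le_span hq
  refine Submodule.span_induction (p := fun q _ ↦ q ∈ S) ?_ S.zero_mem (fun _ _ _ _ h h' ↦
    S.add_mem h h') (fun n x _ h ↦ ?_) h
  · rintro _ ⟨i, j, y, hy, rfl⟩
    rw [sub_eq_add_neg]
    exact (C.reach i y hy.1).trans (C.reach j y hy.2).symm
  · have := S.zsmul_mem h n
    rwa [← int_smul_eq_zsmul (inferInstance)] at this

end PrimitiveCover

lemma SmoothReach.bdry_eq {m : ℕ} {M : Type u} [TopologicalSpace M]
    [ChartedSpace (EuclideanSpace ℝ (Fin m)) M] {x y : M} {q : ChainsModBoundaries M}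
    (h : SmoothReach m x y q) : bdry M q = pointChain y - pointChain x := by
  induction h with
  | refl => simp
  | step γ _ hγ ih => rw [map_add, ih, bdry_pathClass hγ.continuousOn]; abel

variable {m M}

lemma PrimitiveCover.diffs_subset_range (C : PrimitiveCover m M) :
    C.diffs ⊆ LinearMap.range (H1Incl M) := by
  rintro _ ⟨i, j, y, hy, rfl⟩
  rw [range_H1Incl, SetLike.mem_coe, LinearMap.mem_ker, map_sub, (C.reach i y hy.1).bdry_eq,
    (C.reach j y hy.2).bdry_eq, sub_self]

/-- The finitely many classes in `H₁(M, ℤ)` which correspond to `C.diffs`. -/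
def PrimitiveCover.gens (C : PrimitiveCover m M) : Set (H1 M) := H1Incl M ⁻¹' C.diffs

lemma PrimitiveCover.finite_gens (C : PrimitiveCover m M) : C.gens.Finite :=
  C.finite_diff.preimage (H1Incl_injective M).injOn

/-- `H₁(M, ℤ)` is finitely generated. -/
lemma PrimitiveCover.finite_H1 (C : PrimitiveCover m M) : Module.Finite ℤ (H1 M) := by
  refine Module.Finite.of_injective_of_range_le (H1Incl_injective M)
    (Submodule.fg_span C.finite_diff) ?_
  exact (range_H1Incl M).le.trans C.ker_bdry_le_span

lemma PrimitiveCover.Decomposes.exists_list_H1 {C : PrimitiveCover m M} {γ : ℝ → M} {N : ℕ}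
    (h : C.Decomposes γ 0 1 N) (hγ : ContinuousOn γ (Icc 0 1)) (h01 : γ 0 = γ 1) :
    ∃ l : List (H1 M), l.length = N + 1 ∧ (∀ d ∈ l, d ∈ C.gens) ∧
      curveClass γ hγ h01 = l.sum := by
  obtain ⟨l, hl, hd, e⟩ := h.exists_list C h01
  obtain ⟨l', rfl⟩ : ∃ l' : List (H1 M), l'.map (H1Incl M) = l := by
    have : l ∈ range (List.map (H1Incl M)) := by
      rw [range_list_map]
      exact fun d hd' ↦ C.diffs_subset_range (hd d hd')
    exact this
  refine ⟨l', by simpa using hl, fun d hd' ↦ hd _ (List.mem_map_of_mem hd'), ?_⟩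
  apply H1Incl_injective M
  rw [H1Incl_curveClass, e, map_list_sum]

/-- Every class of `H₁(M, ℤ)` is the class of a piecewise smooth closed curve. -/
lemma PrimitiveCover.exists_closedCurve [IsManifold (𝓡 m) ∞ M] (C : PrimitiveCover m M)
    (h : H1 M) :
    ∃ γ : ClosedCurve m M, curveClass γ.toFun γ.continuousOn γ.closed = h := by
  have hq : H1Incl M h ∈ LinearMap.ker (bdry M) := by
    rw [← range_H1Incl]; exact LinearMap.mem_range_self _ h
  obtain ⟨γ, hγ, h0, h1, hc, hp⟩ := (C.smoothReach_of_mem_ker hq).exists_path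
  refine ⟨⟨γ, hγ, h0.trans h1.symm, hp⟩, H1Incl_injective M ?_⟩
  rw [H1Incl_curveClass, hc]

end Cover

/-! ### Lengths of piecewise smooth curves -/

section Length

open Manifold MeasureTheory

variable {m : ℕ} {M : Type u} [TopologicalSpace M] [ChartedSpace (EuclideanSpace ℝ (Fin m)) M]
  [RiemannianBundle (fun x : M ↦ TangentSpace (𝓡 m) x)]

lemma PiecewiseSmooth.riemannianEDist_le {γ : ℝ → M} (hγ : PiecewiseSmooth m γ) {a b : ℝ}
    (ha : 0 ≤ a) (hab : a ≤ b) (hb : b ≤ 1) :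
    riemannianEDist (𝓡 m) (γ a) (γ b) ≤ pathELength (𝓡 m) γ a b := by
  obtain ⟨n, t, t0, tn, ht, hs⟩ := hγ
  have key : ∀ k ≤ n, ∀ a b, 0 ≤ a → a ≤ b → b ≤ t k →
      riemannianEDist (𝓡 m) (γ a) (γ b) ≤ pathELength (𝓡 m) γ a b := by
    intro k
    induction k with
    | zero =>
      intro _ a b ha hab hb
      obtain rfl : a = b := by linarith
      simp [riemannianEDist_self]
    | succ k ih =>
      intro hk a b ha hab hb
      have hsm : ContMDiffOn 𝓘(ℝ) (𝓡 m) 1 γ (Icc (t k) (t (k + 1))) :=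
        (hs k (by omega)).of_le (by simp)
      have hpiece : ∀ a, t k ≤ a → a ≤ b →
          riemannianEDist (𝓡 m) (γ a) (γ b) ≤ pathELength (𝓡 m) γ a b := fun a h1 h2 ↦
        riemannianEDist_le_pathELength (hsm.mono (Icc_subset_Icc h1 hb)) rfl rfl h2
      rcases le_total b (t k) with h | h
      · exact ih (by omega) a b ha hab h
      rcases le_total (t k) a with h' | h'
      · exact hpiece a h' hab
      · rw [← pathELength_add h' h]
        exact riemannianEDist_triangle.trans
          (add_le_add (ih (by omega) a _ ha h' le_rfl) (hpiece _ le_rfl h))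
  exact key n le_rfl a b ha hab (tn ▸ hb)

lemma PrimitiveCover.exists_mapsTo_of_pathELength_lt {C : PrimitiveCover m M} {ε : ℝ≥0}
    (hε : ∀ x, ∃ i, ∀ y, riemannianEDist (𝓡 m) x y < ε → y ∈ C.V i) {γ : ℝ → M}
    (hγ : PiecewiseSmooth m γ) {a b : ℝ} (ha : 0 ≤ a) (hb : b ≤ 1)
    (h : pathELength (𝓡 m) γ a b < ε) : ∃ i, MapsTo γ (Icc a b) (C.V i) := by
  obtain ⟨i, hi⟩ := hε (γ a)
  exact ⟨i, fun s hs ↦ hi _ ((hγ.riemannianEDist_le ha hs.1 (hs.2.trans hb)).trans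
    (pathELength_mono le_rfl hs.2) |>.trans_lt h)⟩

variable [IsManifold (𝓡 m) ∞ M]
  [IsContinuousRiemannianBundle (EuclideanSpace ℝ (Fin m)) (fun x : M ↦ TangentSpace (𝓡 m) x)]

lemma exists_enorm_mfderiv_le {γ : ℝ → M} {a b : ℝ}
    (hγ : ContMDiffOn 𝓘(ℝ) (𝓡 m) 1 γ (Icc a b)) :
    ∃ C : ℝ≥0, ∀ t ∈ Ioo a b, ‖mfderiv 𝓘(ℝ) (𝓡 m) γ t 1‖ₑ ≤ C := by
  rcases le_or_gt b a with hab | hab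
  · exact ⟨0, fun t ht ↦ absurd (ht.1.trans ht.2) hab.not_gt⟩
  have hu : UniqueMDiffOn 𝓘(ℝ) (Icc a b) := (uniqueDiffOn_Icc hab).uniqueMDiffOn
  have h1 : ContinuousOn (fun t : ℝ ↦ (tangentMapWithin 𝓘(ℝ) (𝓡 m) γ (Icc a b)
      (⟨t, (1 : ℝ)⟩ : TangentBundle 𝓘(ℝ) ℝ))) (Icc a b) := by
    refine (hγ.continuousOn_tangentMapWithin le_rfl hu).comp ?_ fun t ht ↦ ht
    exact ((tangentBundleModelSpaceHomeomorph 𝓘(ℝ, ℝ)).symm.continuous.comp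
      (Continuous.prodMk_left (1 : ℝ))).continuousOn
  have h2 : ContinuousOn (fun t : ℝ ↦ inner ℝ (mfderivWithin 𝓘(ℝ) (𝓡 m) γ (Icc a b) t 1)
      (mfderivWithin 𝓘(ℝ) (𝓡 m) γ (Icc a b) t 1)) (Icc a b) :=
    ContinuousOn.inner_bundle (F := EuclideanSpace ℝ (Fin m)) (b := γ) h1 h1
  obtain ⟨C, hC⟩ := isCompact_Icc.exists_bound_of_continuousOn h2
  refine ⟨(√C).toNNReal, fun t ht ↦ ?_⟩
  have h3 := hC t (Ioo_subset_Icc_self ht)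
  rw [mfderivWithin_of_mem_nhds (Icc_mem_nhds ht.1 ht.2), real_inner_self_eq_norm_sq,
    Real.norm_of_nonneg (sq_nonneg _)] at h3
  rw [← ofReal_norm]
  exact ENNReal.ofReal_le_ofReal (Real.le_sqrt_of_sq_le h3)

/-- Lengths of arcs of a piecewise smooth path are at most proportional to the parameter. -/
lemma PiecewiseSmooth.exists_pathELength_le {γ : ℝ → M} (hγ : PiecewiseSmooth m γ) :
    ∃ C : ℝ≥0, ∀ a b : ℝ, 0 ≤ a → b ≤ 1 →
      pathELength (𝓡 m) γ a b ≤ C * ENNReal.ofReal (b - a) := by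
  obtain ⟨n, t, t0, tn, ht, hs⟩ := hγ
  have hC : ∀ i, ∃ C : ℝ≥0, i < n →
      ∀ s ∈ Ioo (t i) (t (i + 1)), ‖mfderiv 𝓘(ℝ) (𝓡 m) γ s 1‖ₑ ≤ C := by
    intro i
    by_cases hi : i < n
    · obtain ⟨C, hC⟩ := exists_enorm_mfderiv_le (m := m) (γ := γ)
        ((hs i hi).of_le (by simp))
      exact ⟨C, fun _ ↦ hC⟩
    · exact ⟨0, fun h ↦ absurd h hi⟩
  choose C hC using hC
  refine ⟨∑ i ∈ Finset.range n, C i, fun a b ha hb ↦ ?_⟩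
  have hnull : ∀ᵐ s ∂(volume.restrict (Icc a b)), s ∉ t '' (Iic n) :=
    ae_restrict_of_ae (measure_eq_zero_iff_ae_notMem.1
      (((finite_Iic n).image t).measure_zero volume))
  have hbound : ∀ᵐ s ∂(volume.restrict (Icc a b)), ‖mfderiv 𝓘(ℝ) (𝓡 m) γ s 1‖ₑ ≤
      ((∑ i ∈ Finset.range n, C i : ℝ≥0) : ℝ≥0∞) := by
    filter_upwards [hnull, ae_restrict_mem measurableSet_Icc] with s hsn hsab
    have hs1 : s < t n := lt_of_le_of_ne (hsab.2.trans (hb.trans tn.ge))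
      fun h ↦ hsn ⟨n, mem_Iic.2 le_rfl, h.symm⟩
    classical
    -- the first subdivision point after `s`
    have hex : ∃ k, s < t k := ⟨n, hs1⟩
    obtain ⟨i, hi⟩ : ∃ i, Nat.find hex = i + 1 := by
      refine Nat.exists_eq_succ_of_ne_zero fun h0 ↦ ?_
      have := Nat.find_spec hex
      rw [h0, t0] at this
      linarith [hsab.1]
    have h1 : s < t (i + 1) := hi ▸ Nat.find_spec hex
    have h2 : t i ≤ s := not_lt.1 (Nat.find_min hex (by omega))
    have hin : i < n := by
      have := Nat.find_min' hex hs1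
      omega
    have h3 : t i < s := lt_of_le_of_ne h2 fun h ↦ hsn ⟨i, hin.le, h⟩
    refine (hC i hin s ⟨h3, h1⟩).trans ?_
    exact_mod_cast Finset.single_le_sum (f := C) (fun _ _ ↦ zero_le) (Finset.mem_range.2 hin)
  calc pathELength (𝓡 m) γ a b = ∫⁻ s in Icc a b, ‖mfderiv 𝓘(ℝ) (𝓡 m) γ s 1‖ₑ :=
        pathELength_eq_lintegral_mfderiv_Icc
    _ ≤ ∫⁻ _ in Icc a b, ((∑ i ∈ Finset.range n, C i : ℝ≥0) : ℝ≥0∞) := lintegral_mono_ae hbound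
    _ = _ := by rw [setLIntegral_const, Real.volume_Icc]

namespace PrimitiveCover

variable (C : PrimitiveCover m M)

/-- Lebesgue number of the cover, for the Riemannian distance. -/
lemma exists_lebesgue_number [CompactSpace M] [RegularSpace M] :
    ∃ ε : ℝ≥0, 0 < ε ∧ ∀ x, ∃ i, ∀ y, riemannianEDist (𝓡 m) x y < ε → y ∈ C.V i := by
  have h1 : ∀ x : M, ∃ i, ∃ c > (0 : ℝ≥0), {y | riemannianEDist (𝓡 m) x y < c} ⊆ C.V i := by
    intro x
    obtain ⟨i, hi⟩ := C.cover x
    exact ⟨i, setOfPred_riemannianEDist_lt_subset_nhds (𝓡 m) ((C.isOpen i).mem_nhds hi)⟩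
  choose i c hc hi using h1
  obtain ⟨t, ht⟩ := CompactSpace.elim_nhds_subcover
    (fun x : M ↦ {y | riemannianEDist (𝓡 m) x y < (c x / 2 : ℝ≥0)})
    fun x ↦ eventually_riemannianEDist_lt (𝓡 m) x (by simpa using (hc x).ne')
  obtain ⟨ε, hε, hεt⟩ : ∃ ε : ℝ≥0, 0 < ε ∧ ∀ x ∈ t, ε ≤ c x / 2 := by
    clear ht
    induction t using Finset.cons_induction with
    | empty => exact ⟨1, one_pos, by simp⟩
    | cons a t _ ih =>
      obtain ⟨ε, hε, h⟩ := ih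
      refine ⟨min ε (c a / 2), lt_min hε (half_pos (hc a)), fun x hx ↦ ?_⟩
      rcases Finset.mem_cons.1 hx with rfl | hx
      · exact min_le_right _ _
      · exact (min_le_left _ _).trans (h x hx)
  refine ⟨ε, hε, fun x ↦ ?_⟩
  have hx : x ∈ ⋃ z ∈ t, {y | riemannianEDist (𝓡 m) z y < (c z / 2 : ℝ≥0)} := ht ▸ mem_univ x
  simp only [mem_iUnion] at hx
  obtain ⟨z, hz, hzx⟩ := hx
  refine ⟨i z, fun y hy ↦ hi z ?_⟩
  calc riemannianEDist (𝓡 m) z y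
      ≤ riemannianEDist (𝓡 m) z x + riemannianEDist (𝓡 m) x y := riemannianEDist_triangle
    _ < (c z / 2 : ℝ≥0) + (c z / 2 : ℝ≥0) :=
      ENNReal.add_lt_add hzx (hy.trans_le (by exact_mod_cast hεt z hz))
    _ = c z := by rw [← ENNReal.coe_add, add_halves]

variable {C}

/-- A path of length less than `(N + 1) ε` splits in `N + 1` arcs of length less than `ε`. -/
lemma decomposes_of_pathELength_lt {ε : ℝ≥0}
    (hε : ∀ x, ∃ i, ∀ y, riemannianEDist (𝓡 m) x y < ε → y ∈ C.V i) {γ : ℝ → M}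
    (hγ : PiecewiseSmooth m γ) (hc : ContinuousOn γ (Icc 0 1)) (N : ℕ) {a : ℝ} (ha : 0 ≤ a)
    (ha1 : a ≤ 1) (h : pathELength (𝓡 m) γ a 1 < (N + 1) * ε) : C.Decomposes γ a 1 N := by
  induction N generalizing a with
  | zero =>
    obtain ⟨i, hi⟩ := exists_mapsTo_of_pathELength_lt hε hγ ha le_rfl (by simpa using h)
    exact .of_mapsTo ha1 (hc.mono (Icc_subset_Icc_left ha)) hi
  | succ N ih =>
    obtain ⟨K, hK⟩ := hγ.exists_pathELength_le
    let ℓ : ℝ → ℝ := fun b ↦ (pathELength (𝓡 m) γ a b).toReal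
    have hfin : ∀ a b, 0 ≤ a → b ≤ 1 → pathELength (𝓡 m) γ a b ≠ ⊤ := fun a b h1 h2 ↦
      ((hK a b h1 h2).trans_lt (ENNReal.mul_lt_top (by simp) (by simp))).ne
    have hadd : ∀ b c, a ≤ b → b ≤ c → c ≤ 1 →
        ℓ c = ℓ b + (pathELength (𝓡 m) γ b c).toReal := fun b c h1 h2 h3 ↦ by
      rw [← ENNReal.toReal_add (hfin _ _ ha (h2.trans h3)) (hfin _ _ (ha.trans h1) h3),
        pathELength_add h1 h2]
    have hℓ : ContinuousOn ℓ (Icc a 1) := by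
      refine (LipschitzOnWith.of_le_add_mul K fun x hx y hy ↦ ?_).continuousOn
      rcases le_total x y with hxy | hxy
      · rw [hadd x y hx.1 hxy hy.2]
        have := ENNReal.toReal_nonneg (a := pathELength (𝓡 m) γ x y)
        have : 0 ≤ K * dist x y := by positivity
        linarith
      · rw [hadd y x hy.1 hxy hx.2]
        gcongr
        refine (ENNReal.toReal_mono (ENNReal.mul_ne_top (by simp) (by simp))
          (hK y x (ha.trans hy.1) hx.2)).trans_eq ?_
        rw [ENNReal.toReal_mul, ENNReal.toReal_ofReal (sub_nonneg.2 hxy), Real.dist_eq,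
          abs_of_nonneg (sub_nonneg.2 hxy), ENNReal.coe_toReal]
    have hℓa : ℓ a = 0 := by simp [ℓ]
    have hℓ0 : 0 ≤ ℓ 1 := ENNReal.toReal_nonneg
    have hℓ1 : ℓ 1 < (N + 2) * ε := by
      have := (ENNReal.toReal_lt_toReal (hfin _ _ ha le_rfl)
        (ENNReal.mul_ne_top (by simp) (by simp))).2 h
      refine this.trans_eq ?_
      rw [ENNReal.toReal_mul, ENNReal.coe_toReal]
      norm_cast
    -- an arc of length less than `ε` is cut off by the intermediate value theorem
    obtain ⟨b, hb, hbε, hbN⟩ : ∃ b ∈ Icc a 1, ℓ b < ε ∧ ℓ 1 - ℓ b < (N + 1) * ε := by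
      rcases lt_or_ge (ℓ 1) ((N + 1) * ε) with hlt | hge
      · exact ⟨a, ⟨le_rfl, ha1⟩, by rw [hℓa]; nlinarith, by rw [hℓa]; linarith⟩
      · obtain ⟨b, hb, hbe⟩ := intermediate_value_Icc ha1 hℓ
          (show (ℓ 1 - N * ε) / 2 ∈ Icc (ℓ a) (ℓ 1) by
            have := ε.2
            constructor
            · rw [hℓa]; linarith
            · have : (0 : ℝ) ≤ N * ε := by positivity
              linarith)
        exact ⟨b, hb, by rw [hbe]; linarith, by rw [hbe]; linarith⟩
    have h1 : pathELength (𝓡 m) γ a b < ε := by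
      rw [← ENNReal.toReal_lt_toReal (hfin _ _ ha hb.2) (by simp)]
      simpa using hbε
    have h2 : pathELength (𝓡 m) γ b 1 < (N + 1) * ε := by
      rw [← ENNReal.toReal_lt_toReal (hfin _ _ (ha.trans hb.1) le_rfl)
        (ENNReal.mul_ne_top (by simp) (by simp))]
      rw [hadd b 1 hb.1 hb.2 le_rfl, add_sub_cancel_left] at hbN
      refine hbN.trans_eq ?_
      rw [ENNReal.toReal_mul, ENNReal.coe_toReal]
      norm_cast
    obtain ⟨i, hi⟩ := exists_mapsTo_of_pathELength_lt hε hγ ha hb.2 h1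
    have h3 := Decomposes.of_mapsTo hb.1 (hc.mono (Icc_subset_Icc ha hb.2)) hi
    simpa using h3.trans hb.1 hb.2 (hc.mono (Icc_subset_Icc_left ha)) (ih (ha.trans hb.1) hb.2 h2)

/-- Every homomorphism from `H₁(M, ℤ)` to a normed group is bounded by a multiple of the length of
closed curves: a curve of length `ℓ` is a sum of at most `ℓ / ε + 1` classes from a finite set, and
it is null-homologous if `ℓ < ε`. -/
lemma exists_norm_curveClass_le (C : PrimitiveCover m M) [CompactSpace M] [RegularSpace M] {E : Type*}
    [NormedAddCommGroup E] (f : H1 M →+ E) :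
    ∃ A : ℝ, 0 < A ∧ ∀ (γ : ℝ → M) (hγ : ContinuousOn γ (Icc 0 1)) (h01 : γ 0 = γ 1),
      PiecewiseSmooth m γ →
        ‖f (curveClass γ hγ h01)‖ ≤ A * (pathELength (𝓡 m) γ 0 1).toReal := by
  obtain ⟨ε, ε0, hε⟩ := C.exists_lebesgue_number
  obtain ⟨K, hK⟩ : ∃ K, ∀ h ∈ C.gens, ‖f h‖ ≤ K := by
    obtain ⟨K, hK⟩ := (C.finite_gens.image fun h ↦ ‖f h‖).bddAbove
    exact ⟨K, fun h hh ↦ hK ⟨h, hh, rfl⟩⟩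
  have hε' : (0 : ℝ) < ε := ε0
  refine ⟨2 * max K 1 / ε, by positivity, fun γ hγ h01 hp ↦ ?_⟩
  obtain ⟨B, hB⟩ := hp.exists_pathELength_le
  have hfin : pathELength (𝓡 m) γ 0 1 ≠ ⊤ :=
    ((hB 0 1 le_rfl le_rfl).trans_lt (ENNReal.mul_lt_top (by simp) (by simp))).ne
  set ℓ := (pathELength (𝓡 m) γ 0 1).toReal with hℓ
  have hℓ0 : 0 ≤ ℓ := ENNReal.toReal_nonneg
  have hof : pathELength (𝓡 m) γ 0 1 = ENNReal.ofReal ℓ := (ENNReal.ofReal_toReal hfin).symm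
  rcases lt_or_ge ℓ ε with hlt | hge
  · obtain ⟨i, hi⟩ := exists_mapsTo_of_pathELength_lt hε hp le_rfl le_rfl (by
      rw [hof]; exact (ENNReal.ofReal_lt_coe_iff hℓ0).2 hlt)
    have h0 : curveClass γ hγ h01 = 0 := by
      apply H1Incl_injective M
      rw [H1Incl_curveClass, map_zero, ← subpathClass_zero_one,
        C.primitive i γ 0 1 zero_le_one hγ hi, h01, sub_self]
    rw [h0, map_zero, norm_zero]
    positivity
  · have hN : pathELength (𝓡 m) γ 0 1 < ((⌊ℓ / ε⌋₊ : ℕ) + 1) * ε := by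
      have h1 := Nat.lt_floor_add_one (ℓ / ε)
      rw [div_lt_iff₀ hε'] at h1
      rw [hof]
      refine ((ENNReal.ofReal_lt_ofReal_iff (hℓ0.trans_lt h1)).2 h1).trans_eq ?_
      rw [ENNReal.ofReal_mul (by positivity), ENNReal.ofReal_coe_nnreal]
      norm_cast
    obtain ⟨l, hl, hd, e⟩ :=
      (decomposes_of_pathELength_lt hε hp hγ _ le_rfl zero_le_one hN).exists_list_H1 hγ h01
    have h2 : ∀ l : List (H1 M), (∀ d ∈ l, d ∈ C.gens) → ‖f l.sum‖ ≤ l.length * max K 1 := by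
      intro l
      induction l with
      | nil => simp
      | cons d l ih =>
        intro h
        rw [List.sum_cons, map_add, List.length_cons]
        have h3 := ih fun d hd ↦ h d (List.mem_cons_of_mem _ hd)
        have h4 := (hK d (h d List.mem_cons_self)).trans (le_max_left K 1)
        push_cast
        linarith [norm_add_le (f d) (f l.sum)]
    have h5 := h2 l hd
    rw [← e, hl] at h5
    push_cast at h5
    have h6 : (⌊ℓ / ε⌋₊ : ℝ) ≤ ℓ / ε := Nat.floor_le (by positivity)
    have h7 : 1 ≤ ℓ / ε := (one_le_div₀ hε').2 hge
    calc _ ≤ _ := h5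
      _ ≤ (ℓ / ε + ℓ / ε) * max K 1 := by gcongr
      _ = _ := by ring

end PrimitiveCover

end Length

/-! ### The homology length spectrum -/

section Spectrum

open MeasureTheory

variable {m : ℕ} {M : Type u} [TopologicalSpace M] [ChartedSpace (EuclideanSpace ℝ (Fin m)) M]
  [IsManifold (𝓡 m) ∞ M]

lemma length_eq (g : RiemMetric m M) (γ : ClosedCurve m M) :
    length g γ = ∫⁻ t in Icc (0 : ℝ) 1,
      ENNReal.ofReal (gnorm g (γ.toFun t) (mfderiv 𝓘(ℝ) (𝓡 m) γ.toFun t (1 : ℝ))) := by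
  let : RiemannianBundle (fun x : M ↦ TangentSpace (𝓡 m) x) := ⟨g.toRiemannianMetric⟩
  refine Manifold.pathELength_eq_lintegral_mfderiv_Icc.trans (lintegral_congr fun t ↦ ?_)
  rw [← ofReal_norm, norm_eq_sqrt_real_inner]
  rfl

lemma length_le_of_bilipAt {g₁ g₂ : RiemMetric m M} {ρ : ℝ≥0} (h : ∀ q, BilipAt g₁ g₂ q ρ)
    (γ : ClosedCurve m M) : length g₂ γ ≤ ENNReal.ofReal (Real.exp ρ) * length g₁ γ := by
  rw [length_eq, length_eq, ← lintegral_const_mul' _ _ ENNReal.ofReal_ne_top]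
  refine lintegral_mono fun t ↦ ?_
  rw [← ENNReal.ofReal_mul (Real.exp_pos _).le]
  exact ENNReal.ofReal_le_ofReal (h _ _).2

lemma length_ne_top (g : RiemMetric m M) (γ : ClosedCurve m M) : length g γ ≠ ⊤ := by
  let : RiemannianBundle (fun x : M ↦ TangentSpace (𝓡 m) x) := ⟨g.toRiemannianMetric⟩
  obtain ⟨B, hB⟩ := PiecewiseSmooth.exists_pathELength_le (m := m) γ.piecewise
  exact ((hB 0 1 le_rfl le_rfl).trans_lt (ENNReal.mul_lt_top (by simp) (by simp))).ne

/-- The infimum of the lengths is finite, so that no information is lost by `ENNReal.toReal` in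
`spectrum`. -/
lemma PrimitiveCover.iInf_length_ne_top (C : PrimitiveCover m M) (g : RiemMetric m M)
    (θ : H1Free M) : (⨅ (γ : ClosedCurve m M) (_ : γ.toH1Free = θ), length g γ) ≠ ⊤ := by
  obtain ⟨h, rfl⟩ := Submodule.Quotient.mk_surjective _ θ
  obtain ⟨γ, hγ⟩ := C.exists_closedCurve h
  have hγ' : γ.toH1Free = Submodule.Quotient.mk h := by rw [ClosedCurve.toH1Free, hγ]
  exact ((iInf₂_le γ hγ').trans_lt (length_ne_top g γ).lt_top).ne

lemma PrimitiveCover.spectrum_le_of_bilipAt (C : PrimitiveCover m M) {g₁ g₂ : RiemMetric m M}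
    {ρ : ℝ≥0} (h : ∀ q, BilipAt g₁ g₂ q ρ) (θ : H1Free M) :
    spectrum g₂ θ ≤ Real.exp ρ * spectrum g₁ θ := by
  have h0 : ENNReal.ofReal (Real.exp ρ) ≠ 0 := by simpa using Real.exp_pos _
  have h1 : (⨅ (γ : ClosedCurve m M) (_ : γ.toH1Free = θ), length g₂ γ) ≤
      ENNReal.ofReal (Real.exp ρ) * ⨅ (γ : ClosedCurve m M) (_ : γ.toH1Free = θ), length g₁ γ := by
    simp only [ENNReal.mul_iInf_of_ne h0 ENNReal.ofReal_ne_top]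
    exact iInf₂_mono fun γ _ ↦ length_le_of_bilipAt h γ
  have h2 := ENNReal.toReal_mono
    (ENNReal.mul_ne_top ENNReal.ofReal_ne_top (C.iInf_length_ne_top g₁ θ)) h1
  rwa [ENNReal.toReal_mul, ENNReal.toReal_ofReal (Real.exp_pos _).le] at h2

lemma bilipAt_of_edist_lt {g₁ g₂ : RiemMetric m M} {ρ : ℝ≥0} (h : edist g₁ g₂ < ρ) (q : M) :
    BilipAt g₁ g₂ q ρ := by
  have h1 : (⨅ (ρ : ℝ≥0) (_ : BilipAt g₁ g₂ q ρ), (ρ : ℝ≥0∞)) < ρ :=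
    (le_iSup (fun q ↦ ⨅ (ρ : ℝ≥0) (_ : BilipAt g₁ g₂ q ρ), (ρ : ℝ≥0∞)) q).trans_lt h
  simp only [iInf_lt_iff] at h1
  obtain ⟨σ, hσ, hσρ⟩ := h1
  have hle : (σ : ℝ) ≤ ρ := by exact_mod_cast hσρ.le
  intro v
  have hn : 0 ≤ gnorm g₁ q v := Real.sqrt_nonneg _
  exact ⟨le_trans (by gcongr) (hσ v).1, (hσ v).2.trans (by gcongr)⟩

/-- The spectrum is bounded below by the norm of any homomorphism to a normed group. -/
lemma PrimitiveCover.exists_norm_le_spectrum [T2Space M] [CompactSpace M] (C : PrimitiveCover m M)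
    {E : Type*} [NormedAddCommGroup E] (F : H1Free M →+ E) (g : RiemMetric m M) :
    ∃ c : ℝ, 0 < c ∧ ∀ θ, c * ‖F θ‖ ≤ spectrum g θ := by
  let : RiemannianBundle (fun x : M ↦ TangentSpace (𝓡 m) x) := ⟨g.toRiemannianMetric⟩
  obtain ⟨A, hA, h⟩ := C.exists_norm_curveClass_le
    (F.comp (Submodule.torsion ℤ (H1 M)).mkQ.toAddMonoidHom)
  refine ⟨A⁻¹, inv_pos.2 hA, fun θ ↦ ?_⟩
  have key : ENNReal.ofReal (A⁻¹ * ‖F θ‖) ≤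
      ⨅ (γ : ClosedCurve m M) (_ : γ.toH1Free = θ), length g γ := by
    refine le_iInf₂ fun γ hγ ↦ ENNReal.ofReal_le_of_le_toReal ?_
    rw [inv_mul_le_iff₀ hA, ← hγ]
    exact h γ.toFun γ.continuousOn γ.closed γ.piecewise
  exact (ENNReal.ofReal_le_iff_le_toReal (C.iInf_length_ne_top g θ)).1 key

end Spectrum

/-! ### Summation over a lattice -/

section Lattice

lemma exists_injective_quotient_torsion (R A : Type*) [CommRing R] [IsDomain R]
    [IsPrincipalIdealRing R] [AddCommGroup A] [Module R A] [Module.Finite R A] :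
    ∃ f : A ⧸ Submodule.torsion R A →+ (Fin (Module.finrank R A) → R), Function.Injective f := by
  have : Module.Free R (A ⧸ Submodule.torsion R A) := Module.free_of_finite_type_torsion_free'
  let B := (Module.finBasis R (A ⧸ Submodule.torsion R A)).reindex
    (finCongr (finrank_quotient_eq_of_le_torsion le_rfl))
  exact ⟨B.equivFun.toLinearMap.toAddMonoidHom, B.equivFun.injective⟩

/-- For the sup norm on `ℤⁿ`, `∑ ‖v‖ ^ (-s)` converges when `s > n`. -/
lemma summable_norm_intCast_rpow {n : ℕ} {s : ℝ} (hs : n < s) :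
    Summable fun v : Fin n → ℤ ↦ ‖(fun i ↦ (v i : ℝ) : Fin n → ℝ)‖ ^ (-s) := by
  let L : Submodule ℤ (Fin n → ℝ) := Submodule.span ℤ (range (Pi.basisFun ℝ (Fin n)))
  have hL : Module.finrank ℤ L = n := by
    have := ZLattice.rank ℝ L
    rwa [Module.finrank_fin_fun] at this
  have hmem (v : Fin n → ℤ) : (fun i ↦ (v i : ℝ) : Fin n → ℝ) ∈ L := by
    rw [(Pi.basisFun ℝ (Fin n)).mem_span_iff_repr_mem ℤ]
    intro i
    exact ⟨v i, by simp⟩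
  have h := (ZLattice.summable_norm_rpow L (-s) (by rw [hL]; linarith)).comp_injective
    (i := fun v : Fin n → ℤ ↦ (⟨_, hmem v⟩ : L)) fun v w hvw ↦ by
      ext i
      have h : (v i : ℝ) = w i := congrFun (congrArg Subtype.val hvw) i
      exact_mod_cast h
  exact h

end Lattice

/-! ### Zeta functions of families of spectra -/

section Zeta

variable {X Θ : Type*} [PseudoEMetricSpace X] {l : X → Θ → ℝ}

/-- The sum of the zeta series. -/
def zetaSum (l : Θ → ℝ) (z : ℂ) : ℂ := ∑' θ, 1 / (l θ : ℂ) ^ z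

lemma norm_one_div_cpow {x : ℝ} (hx : 0 < x) (z : ℂ) : ‖1 / (x : ℂ) ^ z‖ = x ^ (-z.re) := by
  rw [norm_div, norm_one, Complex.norm_cpow_eq_rpow_re_of_pos hx, Real.rpow_neg hx.le, one_div]

lemma rpow_neg_le_add {x s σ τ : ℝ} (hx : 0 < x) (h₁ : σ ≤ s) (h₂ : s ≤ τ) :
    x ^ (-s) ≤ x ^ (-σ) + x ^ (-τ) := by
  have h₃ : 0 ≤ x ^ (-σ) := by positivity
  have h₄ : 0 ≤ x ^ (-τ) := by positivity
  rcases le_total x 1 with h | h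
  · have := Real.rpow_le_rpow_of_exponent_ge hx h (neg_le_neg h₂)
    linarith
  · have := Real.rpow_le_rpow_of_exponent_le h (neg_le_neg h₁)
    linarith

/-- A positive function on `Θ` whose zeta series converges absolutely for `Re z > b`. -/
structure ZetaWeight (w : Θ → ℝ) (b : ℝ) : Prop where
  pos : ∀ θ, 0 < w θ
  summable : ∀ s > b, Summable fun θ ↦ w θ ^ (-s)

/-- On a strip `σ ≤ Re z ≤ τ`, the terms of the zeta series are dominated by a summable
function. -/
lemma ZetaWeight.exists_bound {w : Θ → ℝ} {b : ℝ} (hw : ZetaWeight w b) {c : ℝ} (hc : 0 < c)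
    (hb : 0 ≤ b) {σ τ : ℝ} (hσ : b < σ) (hτ : σ ≤ τ) :
    ∃ u : Θ → ℝ, Summable u ∧ ∀ l : Θ → ℝ, (∀ θ, c * w θ ≤ l θ) →
      ∀ z : ℂ, σ ≤ z.re → z.re ≤ τ → ∀ θ, ‖1 / (l θ : ℂ) ^ z‖ ≤ u θ := by
  refine ⟨fun θ ↦ c ^ (-σ) * w θ ^ (-σ) + c ^ (-τ) * w θ ^ (-τ),
    ((hw.summable σ hσ).mul_left _).add ((hw.summable τ (hσ.trans_le hτ)).mul_left _), ?_⟩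
  intro l hl z h₁ h₂ θ
  have hcw : 0 < c * w θ := mul_pos hc (hw.pos θ)
  dsimp only
  rw [norm_one_div_cpow (hcw.trans_le (hl θ)), ← Real.mul_rpow hc.le (hw.pos θ).le,
    ← Real.mul_rpow hc.le (hw.pos θ).le]
  exact (Real.rpow_le_rpow_of_nonpos hcw (hl θ) (by linarith)).trans (rpow_neg_le_add hcw h₁ h₂)

lemma ZetaWeight.summable_zeta {w : Θ → ℝ} {b : ℝ} (hw : ZetaWeight w b) {c : ℝ} (hc : 0 < c)
    (hb : 0 ≤ b) {l : Θ → ℝ} (hl : ∀ θ, c * w θ ≤ l θ) {z : ℂ} (hz : b < z.re) :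
    Summable fun θ ↦ 1 / (l θ : ℂ) ^ z := by
  obtain ⟨u, hu, h⟩ := hw.exists_bound hc hb hz le_rfl
  exact hu.of_norm_bounded (h l hl z le_rfl le_rfl)

lemma isOpen_strip (σ τ : ℝ) : IsOpen (Complex.re ⁻¹' Ioo σ τ) :=
  isOpen_Ioo.preimage Complex.continuous_re

lemma ZetaWeight.differentiableOn_zetaSum {w : Θ → ℝ} {b : ℝ} (hw : ZetaWeight w b) {c : ℝ}
    (hc : 0 < c) (hb : 0 ≤ b) {l : Θ → ℝ} (hl : ∀ θ, c * w θ ≤ l θ) :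
    DifferentiableOn ℂ (zetaSum l) (halfPlane b) := by
  intro z hz
  obtain ⟨σ, h₁, h₂⟩ := exists_between (show b < z.re from hz)
  obtain ⟨u, hu, h⟩ := hw.exists_bound hc hb h₁ (h₂.le.trans (lt_add_one z.re).le)
  have hd : DifferentiableOn ℂ (zetaSum l) (Complex.re ⁻¹' Ioo σ (z.re + 1)) := by
    refine Complex.differentiableOn_tsum_of_summable_norm hu (fun θ ↦ ?_) (isOpen_strip _ _)
      fun θ w hw ↦ h l hl w hw.1.le hw.2.le θ
    have hlθ : 0 < l θ := (mul_pos hc (hw.pos θ)).trans_le (hl θ)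
    have h0 : (l θ : ℂ) ≠ 0 := Complex.ofReal_ne_zero.2 hlθ.ne'
    intro w _
    refine DifferentiableAt.differentiableWithinAt ?_
    refine (differentiableAt_const _).div (differentiableAt_id.const_cpow (Or.inl h0)) ?_
    simp [Complex.cpow_eq_zero_iff, h0]
  exact (hd.differentiableAt ((isOpen_strip _ _).mem_nhds
    ⟨h₂, lt_add_one z.re⟩)).differentiableWithinAt

lemma ZetaWeight.zetaConvergesTo {w : Θ → ℝ} {b : ℝ} (hw : ZetaWeight w b) {c : ℝ} (hc : 0 < c)
    (hb : 0 ≤ b) {l : Θ → ℝ} (hl : ∀ θ, c * w θ ≤ l θ) {z : ℂ} (hz : b < z.re) :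
    ZetaConvergesTo l z (zetaSum l z) := by
  have hsum := hw.summable_zeta hc hb hl hz
  have hpos : ∀ θ, 0 < l θ := fun θ ↦ (mul_pos hc (hw.pos θ)).trans_le (hl θ)
  have hfin : ∀ t : ℝ, 0 < t → {θ | l θ ≤ t}.Finite := by
    intro t ht
    -- the terms with `l θ ≤ t` are at least `t ^ (-Re z)`, as `Re z ≥ 0`
    have h1 := hsum.norm.tendsto_cofinite_zero.eventually_lt_const
      (show 0 < t ^ (-z.re) by positivity)
    refine (eventually_cofinite.1 h1).subset fun θ hθ ↦ ?_
    rw [mem_ofPred_eq, not_lt, norm_one_div_cpow (hpos θ)]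
    exact Real.rpow_le_rpow_of_nonpos (hpos θ) hθ (by linarith)
  refine ⟨hfin, ?_⟩
  have hfin' : ∀ t : ℝ, {θ | l θ ≤ t}.Finite := fun t ↦
    (hfin (max t 1) (by positivity)).subset fun θ (hθ : l θ ≤ t) ↦
      show l θ ≤ max t 1 from hθ.trans (le_max_left t 1)
  have h2 : Tendsto (fun t ↦ (hfin' t).toFinset) atTop atTop := by
    refine tendsto_atTop_finset_of_monotone (fun s t hst ↦ ?_) fun θ ↦ ⟨l θ, by simp⟩
    exact Finite.toFinset_subset_toFinset.2 fun θ (hθ : l θ ≤ s) ↦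
      show l θ ≤ t from hθ.trans hst
  refine (hsum.hasSum.comp h2).congr fun t ↦ ?_
  exact (finsum_mem_eq_finite_toFinset_sum _ (hfin' t)).symm

/-- A function that changes at most by a factor `e^ρ` between points at distance less
than `ρ` is continuous. -/
lemma continuous_of_le_exp_mul {f : X → ℝ}
    (h : ∀ (x y : X) (ρ : ℝ≥0), edist x y < ρ → f y ≤ Real.exp ρ * f x) : Continuous f := by
  refine continuous_iff_continuousAt.2 fun x ↦ ?_
  have hball : ∀ ρ : ℝ≥0, 0 < ρ → ∀ᶠ y in 𝓝 x, edist y x < ρ := fun ρ hρ ↦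
    Metric.eball_mem_nhds x (by simpa using hρ)
  have hlim : Tendsto (fun ρ : ℝ≥0 ↦ Real.exp ρ * f x) (𝓝[>] 0) (𝓝 (f x)) := by
    have : Continuous fun ρ : ℝ≥0 ↦ Real.exp ρ * f x := by fun_prop
    simpa using (this.tendsto 0).mono_left nhdsWithin_le_nhds
  have hlim' : Tendsto (fun ρ : ℝ≥0 ↦ Real.exp (-ρ) * f x) (𝓝[>] 0) (𝓝 (f x)) := by
    have : Continuous fun ρ : ℝ≥0 ↦ Real.exp (-ρ) * f x := by fun_prop
    simpa using (this.tendsto 0).mono_left nhdsWithin_le_nhds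
  refine tendsto_order.2 ⟨fun a ha ↦ ?_, fun a ha ↦ ?_⟩
  · obtain ⟨ρ, hρ, hρ0⟩ := ((hlim'.eventually_const_lt ha).and self_mem_nhdsWithin).exists
    filter_upwards [hball ρ hρ0] with y hy
    refine hρ.trans_le ?_
    rw [Real.exp_neg, inv_mul_le_iff₀ (Real.exp_pos _)]
    exact h y x ρ hy
  · obtain ⟨ρ, hρ, hρ0⟩ := ((hlim.eventually_lt_const ha).and self_mem_nhdsWithin).exists
    filter_upwards [hball ρ hρ0] with y hy
    exact (h x y ρ (by rwa [edist_comm])).trans_lt hρ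

/-- The zeta function is jointly continuous in the spectrum and in the exponent. -/
lemma ZetaWeight.continuous_zetaSum {w : Θ → ℝ} {b : ℝ} (hw : ZetaWeight w b) (hb : 0 ≤ b)
    (hl : ∀ x, ∃ c : ℝ, 0 < c ∧ ∀ θ, c * w θ ≤ l x θ)
    (h : ∀ (x y : X) (ρ : ℝ≥0), edist x y < ρ → ∀ θ, l y θ ≤ Real.exp ρ * l x θ) :
    Continuous fun p : X × halfPlane b ↦ zetaSum (l p.1) p.2 := by
  have hpos : ∀ x θ, 0 < l x θ := fun x θ ↦ by
    obtain ⟨c, hc, hcl⟩ := hl x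
    exact (mul_pos hc (hw.pos θ)).trans_le (hcl θ)
  have hcont : ∀ θ, Continuous fun x ↦ l x θ := fun θ ↦
    continuous_of_le_exp_mul fun x y ρ hxy ↦ h x y ρ hxy θ
  refine continuous_iff_continuousAt.2 fun ⟨x, z, hz⟩ ↦ ?_
  obtain ⟨σ, h₁, h₂⟩ := exists_between (show b < z.re from hz)
  obtain ⟨c, hc, hcl⟩ := hl x
  obtain ⟨u, hu, hbd⟩ := hw.exists_bound (mul_pos (Real.exp_pos (-1)) hc) hb h₁
    (h₂.le.trans (lt_add_one z.re).le)
  let S : Set (X × halfPlane b) :=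
    Metric.eball x 1 ×ˢ (Subtype.val ⁻¹' (Complex.re ⁻¹' Ioo σ (z.re + 1)))
  have hS : IsOpen S :=
    Metric.isOpen_eball.prod ((isOpen_strip _ _).preimage continuous_subtype_val)
  have hx : (x, (⟨z, hz⟩ : halfPlane b)) ∈ S :=
    ⟨Metric.mem_eball_self one_pos, h₂, lt_add_one z.re⟩
  refine ContinuousOn.continuousAt (s := S) ?_ (hS.mem_nhds hx)
  refine continuousOn_tsum (fun θ ↦ ?_) hu fun θ p hp ↦ ?_
  · refine Continuous.continuousOn ?_
    have h0 : ∀ p : X × halfPlane b, (l p.1 θ : ℂ) ∈ Complex.slitPlane := fun p ↦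
      Complex.ofReal_mem_slitPlane.2 (hpos _ θ)
    refine continuous_const.div (Continuous.cpow ?_ ?_ h0) fun p ↦ ?_
    · exact Complex.continuous_ofReal.comp ((hcont θ).comp continuous_fst)
    · exact continuous_subtype_val.comp continuous_snd
    · simp [Complex.cpow_eq_zero_iff, (hpos p.1 θ).ne']
  · refine hbd (l p.1) (fun θ ↦ ?_) p.2 hp.2.1.le hp.2.2.le θ
    have h3 := h p.1 x 1 (by simpa using hp.1) θ
    rw [mul_assoc, Real.exp_neg, inv_mul_le_iff₀ (Real.exp_pos _)]
    exact (hcl θ).trans (by simpa using h3)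

/-- The zeta functions form a continuous family of holomorphic functions. -/
lemma ZetaWeight.exists_continuous_holo {w : Θ → ℝ} {b : ℝ} (hw : ZetaWeight w b) (hb : 0 ≤ b)
    (hl : ∀ x, ∃ c : ℝ, 0 < c ∧ ∀ θ, c * w θ ≤ l x θ)
    (h : ∀ (x y : X) (ρ : ℝ≥0), edist x y < ρ → ∀ θ, l y θ ≤ Real.exp ρ * l x θ) :
    ∃ Z : X → Holo b, (∀ x z, (Z x).1 z = zetaSum (l x) z) ∧ Continuous Z := by
  have hcont := hw.continuous_zetaSum hb hl h
  have hcont' (x : X) : Continuous fun z : halfPlane b ↦ zetaSum (l x) z :=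
    Continuous.comp (g := fun p : X × halfPlane b ↦ zetaSum (l p.1) p.2) (f := fun z ↦ (x, z))
      hcont (Continuous.prodMk_right x)
  let Z₀ (x : X) : C(halfPlane b, ℂ) := ⟨fun z ↦ zetaSum (l x) z, hcont' x⟩
  have hZ₀ : Continuous Z₀ := ContinuousMap.continuous_of_continuous_uncurry Z₀ hcont
  have hdiff (x : X) : DifferentiableOn ℂ (zetaSum (l x)) (halfPlane b) := by
    obtain ⟨c, hc, hcl⟩ := hl x
    exact hw.differentiableOn_zetaSum hc hb hcl
  exact ⟨fun x ↦ ⟨Z₀ x, zetaSum (l x), hdiff x, fun _ ↦ rfl⟩, fun _ _ ↦ rfl, hZ₀.subtype_mk _⟩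

end Zeta

/-! ### The zeta function of a compact manifold -/

/-- The first homology modulo torsion of a compact connected manifold is a lattice of rank `b₁` on
which the spectrum is bounded below by a norm. -/
lemma exists_zetaWeight_le_spectrum (m : ℕ) (M : Type u) [TopologicalSpace M]
    [ChartedSpace (EuclideanSpace ℝ (Fin m)) M] [IsManifold (𝓡 m) ∞ M] [T2Space M]
    [CompactSpace M] (C : PrimitiveCover m M) :
    ∃ w : Theta M → ℝ, ZetaWeight w (b1 M) ∧
      ∀ g : RiemMetric m M, ∃ c : ℝ, 0 < c ∧ ∀ θ : Theta M, c * w θ ≤ spectrum g θ.1 := by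
  have := C.finite_H1
  obtain ⟨f, hf⟩ := exists_injective_quotient_torsion ℤ (H1 M)
  let F : H1Free M →+ (Fin (b1 M) → ℝ) := (Int.castAddHom ℝ).compLeft _ |>.comp f
  refine ⟨fun θ ↦ ‖F θ.1‖, ⟨fun θ ↦ norm_pos_iff.2 fun h ↦ θ.2 ?_, fun s hs ↦ ?_⟩, fun g ↦ ?_⟩
  · refine hf (funext fun i ↦ ?_)
    have h0 : (f θ.1 i : ℝ) = 0 := congrFun h i
    rw [map_zero]
    exact_mod_cast h0
  · exact (summable_norm_intCast_rpow hs).comp_injective (hf.comp Subtype.val_injective)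
  · obtain ⟨c, hc, h⟩ := C.exists_norm_le_spectrum F g
    exact ⟨c, hc, fun θ ↦ h θ.1⟩

end SystolicZeta

end

theorem proposition5p1 (m : ℕ) (M : Type u) [TopologicalSpace M]
    [ChartedSpace (EuclideanSpace ℝ (Fin m)) M] [IsManifold (𝓡 m) ∞ M]
    [T2Space M] [CompactSpace M] [ConnectedSpace M] :
    ∃ Z : SystolicZeta.RiemMetric m M → SystolicZeta.Holo (SystolicZeta.b1 M),
      (∀ (g : SystolicZeta.RiemMetric m M),
        (∀ θ : SystolicZeta.Theta M, 0 < SystolicZeta.spectrum g θ.1) ∧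
        ∀ z : SystolicZeta.halfPlane (SystolicZeta.b1 M),
          SystolicZeta.ZetaConvergesTo
            (fun θ : SystolicZeta.Theta M ↦ SystolicZeta.spectrum g θ.1) z ((Z g).1 z)) ∧
      Continuous Z := by
  obtain ⟨C⟩ := SystolicZeta.nonempty_primitiveCover m M
  obtain ⟨w, hw, hl⟩ := SystolicZeta.exists_zetaWeight_le_spectrum m M C
  have hb : (0 : ℝ) ≤ SystolicZeta.b1 M := Nat.cast_nonneg _
  let l (g : SystolicZeta.RiemMetric m M) (θ : SystolicZeta.Theta M) : ℝ :=
    SystolicZeta.spectrum g θ.1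
  have hexp (g₁ g₂ : SystolicZeta.RiemMetric m M) (ρ : ℝ≥0) (h : edist g₁ g₂ < ρ)
      (θ : SystolicZeta.Theta M) : l g₂ θ ≤ Real.exp ρ * l g₁ θ :=
    C.spectrum_le_of_bilipAt (SystolicZeta.bilipAt_of_edist_lt h) θ.1
  obtain ⟨Z, hZ, hZc⟩ := hw.exists_continuous_holo (l := l) hb hl hexp
  refine ⟨Z, fun g ↦ ?_, hZc⟩
  obtain ⟨c, hc, h⟩ := hl g
  refine ⟨fun θ ↦ (mul_pos hc (hw.pos θ)).trans_le (h θ), fun z ↦ ?_⟩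
  rw [hZ]
  exact hw.zetaConvergesTo hc hb h z.2
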